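/- Let $\Bbbk$ be an algebraically closed field of characteristic zero, $\mathfrak g=\mathfrak{sl}_2(\Bbbk)$ with standard basis $e,h,f$, $\mathcal A=\Bbbk[t,t^{-1}]$, and let $\hat{\mathfrak g}=\mathfrak g\otimes\mathcal A$ be the loop algebra with bracket $[x\otimes a,y\otimes b]=[x,y]\otimes ab$. A function $\varphi:\mathbb Z\to\Bbbk$ is exponential polynomial if it is a linear combination of functions $m\mapsto m^j\lambda^m$ with $j\geqslant 0$, $\lambda\in\Bbbk^\times$. The algebra $\mathcal A$ acts on functions $\mathbb Z\to\Bbbk$ by $(t\cdot\varphi)(m)=\varphi(m+1)$, and the characteristic polynomial $c_\varphi$ of an exponential-polynomial function $\varphi$ is the monic generator of the (non-zero) ideal of those $c\in\Bbbk[t]$ with $c\cdot\varphi=0$. If $\varphi$ is exponential polynomial and non-zero, its degree $\deg\varphi$ is the positive integer $r$ such that the additive submonoid of $\mathbb Z$ generated by the support of $\varphi$ is $r\mathbb Z$. Put $\kappa_r(m)=\sum_{\zeta^r=1}\zeta^m$. For $\varphi$ exponential polynomial, let $L(\varphi)$ be the unique irreducible quotient of the $\hat{\mathfrak g}$-module induced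 from the one-dimensional $(\mathfrak g_+\otimes\mathcal A)+(h\otimes\mathcal A)$-module $\Bbbk v_\varphi$, $\mathfrak g_+=\Bbbk e$, on which $e\otimes a$ acts by zero and $h\otimes a$ acts by $(a\cdot\varphi)(0)$. Put $$L(\varphi)_n=\{w\in L(\varphi) : (h\otimes 1)w=(\varphi(0)-2n)w\},\qquad n\geqslant 0 .$$ If $\varphi\neq 0$, $r=\deg\varphi$, and $\zeta$ is a primitive $r$-th root of unity, let $\eta_\varphi$ be the automorphism of the vector space $L(\varphi)$ determined by $\eta_\varphi(v_\varphi)=v_\varphi$ and $\eta_\varphi((x\otimes a(t))w)=(x\otimes a(\zeta^{-1}t))\,\eta_\varphi(w)$ for all $x\in\mathfrak g$, $a\in\mathcal A$, $w\in L(\varphi)$. **Proposition.** Let $\varphi$ be a non-zero exponential-polynomial function, $r=\deg\varphi$, and let $\zeta$ be a primitive $r$-th root of unity in $\Bbbk$. Let $\psi$ be an exponential-polynomial function such that $\varphi=\kappa_r\psi$, the polynomials $c_\psi(\zeta^it)$, $0\leqslant i<r$, are pairwise coprime, and $c_\varphi(t)=\prod_{i=0}^{r-1}c_\psi(\zeta^it)$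 up to a non-zero scalar. Then $L(\varphi)=\bigoplus_{n\geqslant 0}L(\varphi)_n$ and $L(\psi)=\bigoplus_{n\geqslant 0}L(\psi)_n$ with all $L(\varphi)_n$ and $L(\psi)_n$ finite-dimensional, and there is an isomorphism of vector spaces $$\Omega:L(\varphi)\to L(\psi)^{\otimes r}$$ that is graded, i.e. $\Omega(L(\varphi)_n)=\sum_{n_1+\cdots+n_r=n}L(\psi)_{n_1}\otimes\cdots\otimes L(\psi)_{n_r}$ for all $n\geqslant 0$, and satisfies $\Omega\circ\eta_\varphi\circ\Omega^{-1}=\sigma_r$, where $\sigma_r$ is the cyclic permutation $v_1\otimes\cdots\otimes v_r\mapsto v_r\otimes v_1\otimes\cdots\otimes v_{r-1}$. -/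

import Mathlib

noncomputable section

namespace LoopSl2

open Polynomial LaurentPolynomial TensorProduct

variable {k : Type*} [Field k]

/-! ## Exponential-polynomial functions -/

/-- The function `m ↦ m ^ j * l ^ m` on the integers. -/
def epBasis (l : kˣ) (j : ℕ) : ℤ → k := fun m => (m : k) ^ j * ((l ^ m : kˣ) : k)

/-- The space of exponential-polynomial functions `ℤ → k`: finite sums of products of polynomial
functions and exponential functions `m ↦ l ^ m`. -/
def expPoly (k : Type*) [Field k] : Submodule k (ℤ → k) :=
  Submodule.span k {f | ∃ (l : kˣ) (j : ℕ), f = epBasis l j}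

/-- The function `m ↦ ∑_{ζ ^ r = 1} ζ ^ m`. -/
def kron (k : Type*) [Field k] (r : ℕ) : ℤ → k :=
  fun m => ∑ z ∈ nthRootsFinset r (1 : k), z ^ m

/-- The shift `(n • φ) (m) = φ (m + n)`, as a monoid homomorphism in `n`. -/
def shift (k : Type*) [Field k] : Multiplicative ℤ →* Module.End k (ℤ → k) where
  toFun n :=
    { toFun := fun φ m => φ (m + n.toAdd)
      map_add' := fun _ _ => rfl
      map_smul' := fun _ _ => rfl }
  map_one' := by ext; simp
  map_mul' a b := by
    refine LinearMap.ext fun φ => funext fun m => ?_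
    simp only [Module.End.mul_apply, LinearMap.coe_mk, AddHom.coe_mk, toAdd_mul]
    congr 1
    ring

/-- The action of Laurent polynomials on functions `ℤ → k` in which `t` acts as the shift
`(t • φ) (m) = φ (m + 1)`. -/
def act (k : Type*) [Field k] : k[T;T⁻¹] →ₐ[k] Module.End k (ℤ → k) :=
  AddMonoidAlgebra.lift k (Module.End k (ℤ → k)) ℤ (shift k)

/-- The annihilator of `φ` in the polynomial ring `k[t]`. -/
def annIdeal (φ : ℤ → k) : Ideal k[X] where
  carrier := {p | act k (toLaurent p) φ = 0}
  zero_mem' := by simp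
  add_mem' {a b} ha hb := by
    have ha' : act k (toLaurent a) φ = 0 := ha
    have hb' : act k (toLaurent b) φ = 0 := hb
    simp [ha', hb']
  smul_mem' c {a} ha := by
    have ha' : act k (toLaurent a) φ = 0 := ha
    simp [ha']

/-- The characteristic polynomial of `φ`: the monic generator of its annihilator in `k[t]`. -/
def charPoly (φ : ℤ → k) : k[X] :=
  Polynomial.C (Submodule.IsPrincipal.generator (annIdeal φ)).leadingCoeff⁻¹ *
    Submodule.IsPrincipal.generator (annIdeal φ)

/-- The additive submonoid of `ℤ` generated by the support of `φ` is `r ℤ`, with `r` positive. -/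
def IsDegree (φ : ℤ → k) (r : ℕ) : Prop :=
  0 < r ∧ (AddSubmonoid.closure (Function.support φ) : Set ℤ) = {m : ℤ | (r : ℤ) ∣ m}

/-- The degree of `φ`: the positive integer `r` such that the additive submonoid of `ℤ` generated
by the support of `φ` is `r ℤ`.  It exists, and is unique, if `φ` is a non-zero
exponential-polynomial function. -/
def degree (φ : ℤ → k) : ℕ := sInf {r : ℕ | IsDegree φ r}

section DegreeExists

/-- Exponential-polynomial functions lie in finite-dimensional shift-stable spaces. -/
theorem exists_stable {φ : ℤ → k} (hφ : φ ∈ expPoly k) :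
    ∃ W : Submodule k (ℤ → k), FiniteDimensional k W ∧ φ ∈ W ∧
      ∀ f ∈ W, (fun m => f (m + 1)) ∈ W := by
  refine Submodule.span_induction ?_ ?_ ?_ ?_ hφ
  · rintro _ ⟨l, j, rfl⟩
    refine ⟨Submodule.span k (Set.range fun i : Fin (j + 1) => epBasis l i), ?_, ?_, ?_⟩
    · exact FiniteDimensional.span_of_finite k (Set.finite_range _)
    · exact Submodule.subset_span ⟨Fin.last j, by simp⟩
    · intro f hf
      refine Submodule.span_induction (p := fun f _ => (fun m : ℤ => f (m + 1)) ∈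
        Submodule.span k (Set.range fun i : Fin (j + 1) => epBasis l i)) ?_ ?_ ?_ ?_ hf
      · rintro _ ⟨i, rfl⟩
        have : (fun m : ℤ => epBasis l i (m + 1)) =
            ∑ a ∈ Finset.range (i + 1), ((l : k) * ((i : ℕ).choose a : k)) • epBasis l a := by
          funext m
          simp only [epBasis, Finset.sum_apply, Pi.smul_apply, smul_eq_mul]
          push_cast
          rw [add_pow, Finset.sum_mul]
          refine Finset.sum_congr rfl fun a _ => ?_
          rw [zpow_add_one₀ l.ne_zero]
          ring
        simp only [this]
        refine Submodule.sum_mem _ fun a ha => Submodule.smul_mem _ _ ?_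
        have h1 := Finset.mem_range.1 ha
        exact Submodule.subset_span ⟨⟨a, by omega⟩, rfl⟩
      · exact Submodule.zero_mem _
      · intro f g _ _ hf hg
        exact Submodule.add_mem _ hf hg
      · intro c f _ hf
        exact Submodule.smul_mem _ c hf
  · exact ⟨⊥, inferInstance, Submodule.zero_mem _, by
      intro f hf
      rw [Submodule.mem_bot] at hf ⊢
      subst hf
      rfl⟩
  · rintro f g _ _ ⟨V, hV, hfV, sV⟩ ⟨W, hW, hgW, sW⟩
    refine ⟨V ⊔ W, inferInstance, Submodule.add_mem_sup hfV hgW, ?_⟩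
    intro a ha
    obtain ⟨b, hb, c, hc, rfl⟩ := Submodule.mem_sup.1 ha
    exact Submodule.add_mem_sup (sV b hb) (sW c hc)
  · rintro c f _ ⟨V, hV, hfV, sV⟩
    exact ⟨V, hV, Submodule.smul_mem _ c hfV, sV⟩

/-- An exponential-polynomial function that vanishes on the positive integers is zero. -/
theorem eq_zero_of_pos {φ : ℤ → k} (hφ : φ ∈ expPoly k) (h : ∀ m : ℤ, 0 < m → φ m = 0) :
    φ = 0 := by
  obtain ⟨W, hW, hφW, sW⟩ := exists_stable hφ
  let U : Submodule k (ℤ → k) :=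
    W ⊓ { carrier := {f | ∀ m : ℤ, 0 < m → f m = 0}
          zero_mem' := fun _ _ => rfl
          add_mem' := fun {a b} ha hb m hm => by simp [ha m hm, hb m hm]
          smul_mem' := fun c f hf m hm => by simp [hf m hm] }
  have hU : FiniteDimensional k U := Submodule.finiteDimensional_inf_left _ _
  let s : U →ₗ[k] U :=
    { toFun := fun f => ⟨fun m => f.1 (m + 1), sW _ f.2.1, fun m hm => f.2.2 _ (by omega)⟩
      map_add' := fun _ _ => rfl
      map_smul' := fun _ _ => rfl }
  have hs : Function.Injective s := by
    intro f g hfg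
    refine Subtype.ext (funext fun m => ?_)
    have := congrFun (congrArg Subtype.val hfg) (m - 1)
    simpa [s] using this
  have hsurj : Function.Surjective s := LinearMap.injective_iff_surjective.1 hs
  have key : ∀ (n : ℕ) (f : U), f.1 (1 - n) = 0 := by
    intro n
    induction n with
    | zero => intro f; exact f.2.2 _ (by simp)
    | succ n ih =>
      intro f
      obtain ⟨g, rfl⟩ := hsurj f
      have := ih g
      simp only [s, LinearMap.coe_mk, AddHom.coe_mk]
      convert this using 2
      push_cast
      ring
  funext m
  by_cases hm : 0 < m
  · exact h m hm
  · have := key (1 - m).toNat ⟨φ, hφW, h⟩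
    rwa [show (1 : ℤ) - ((1 - m).toNat : ℤ) = m by omega] at this

/-- Exponential-polynomial functions are stable under `m ↦ -m`. -/
theorem neg_mem {φ : ℤ → k} (hφ : φ ∈ expPoly k) : (fun m => φ (-m)) ∈ expPoly k := by
  refine Submodule.span_induction (p := fun f _ => (fun m => f (-m)) ∈ expPoly k) ?_ ?_ ?_ ?_ hφ
  · rintro _ ⟨l, j, rfl⟩
    have : (fun m : ℤ => epBasis l j (-m)) = ((-1 : k) ^ j) • epBasis l⁻¹ j := by
      funext m
      simp only [epBasis, Pi.smul_apply, smul_eq_mul, inv_zpow', Int.cast_neg]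
      rw [neg_pow]
      ring
    rw [this]
    exact Submodule.smul_mem _ _ (Submodule.subset_span ⟨_, _, rfl⟩)
  · exact Submodule.zero_mem _
  · intro f g _ _ hf hg
    exact Submodule.add_mem _ hf hg
  · intro c f _ hf
    exact Submodule.smul_mem _ c hf

/-- A submonoid of `ℤ` with a positive and a negative element is `r ℤ` for some `r > 0`. -/
theorem exists_of_submonoid (A : AddSubmonoid ℤ) {a b : ℤ} (ha : a ∈ A) (hb : b ∈ A)
    (ha0 : 0 < a) (hb0 : b < 0) : ∃ r : ℕ, 0 < r ∧ (A : Set ℤ) = {m : ℤ | (r : ℤ) ∣ m} := by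
  have hneg : ∀ x ∈ A, -x ∈ A := by
    intro x hx
    rcases lt_trichotomy x 0 with h | h | h
    · have h1 := A.add_mem (A.nsmul_mem ha x.natAbs) (A.nsmul_mem hx (a.toNat - 1))
      convert h1 using 1
      simp only [nsmul_eq_mul]
      have h2 : ((a.toNat - 1 : ℕ) : ℤ) = a - 1 := by omega
      have h3 : (x.natAbs : ℤ) = -x := by omega
      rw [h2, h3]
      ring
    · simp [h]
    · have h1 := A.add_mem (A.nsmul_mem hb x.natAbs) (A.nsmul_mem hx (b.natAbs - 1))
      convert h1 using 1
      simp only [nsmul_eq_mul]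
      have h2 : ((b.natAbs - 1 : ℕ) : ℤ) = -b - 1 := by omega
      have h3 : (x.natAbs : ℤ) = x := by omega
      rw [h2, h3]
      ring
  let G : AddSubgroup ℤ := { A with neg_mem' := fun {x} hx => hneg x hx }
  obtain ⟨g, hg⟩ := Int.subgroup_cyclic G
  have hmem : ∀ m : ℤ, m ∈ A ↔ g ∣ m := by
    intro m
    have : m ∈ G ↔ g ∣ m := by
      rw [hg, AddSubgroup.mem_closure_singleton]
      constructor
      · rintro ⟨n, rfl⟩
        simp
      · rintro ⟨n, rfl⟩
        exact ⟨n, by simp [mul_comm]⟩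
    exact this
  refine ⟨g.natAbs, ?_, ?_⟩
  · rw [Int.natAbs_pos]
    rintro rfl
    have := (hmem a).1 ha
    rw [zero_dvd_iff] at this
    omega
  · ext m
    simpa using hmem m

/-- The degree of a non-zero exponential-polynomial function exists. -/
theorem isDegree_degree {φ : ℤ → k} (hφ : φ ∈ expPoly k) (h0 : φ ≠ 0) :
    IsDegree φ (degree φ) := by
  refine Nat.sInf_mem (s := {r : ℕ | IsDegree φ r}) ?_
  have h1 : ∃ a : ℤ, 0 < a ∧ φ a ≠ 0 := by
    by_contra! h
    exact h0 (eq_zero_of_pos hφ h)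
  have h2 : ∃ b : ℤ, b < 0 ∧ φ b ≠ 0 := by
    by_contra! h
    have h3 := eq_zero_of_pos (neg_mem hφ) fun m hm => h (-m) (by omega)
    refine h0 (funext fun m => ?_)
    simpa using congrFun h3 (-m)
  obtain ⟨a, ha, ha'⟩ := h1
  obtain ⟨b, hb, hb'⟩ := h2
  exact exists_of_submonoid _ (AddSubmonoid.subset_closure ha') (AddSubmonoid.subset_closure hb')
    ha hb

theorem zpow_mul_eq {φ : ℤ → k} (hφ : φ ∈ expPoly k) (h0 : φ ≠ 0) {z : kˣ}
    (hz : z ^ degree φ = 1) (m : ℤ) : ((z ^ m : kˣ) : k) * φ m = φ m := by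
  by_cases hm : φ m = 0
  · simp [hm]
  · have h1 : m ∈ (AddSubmonoid.closure (Function.support φ) : Set ℤ) :=
      AddSubmonoid.subset_closure hm
    rw [(isDegree_degree hφ h0).2] at h1
    obtain ⟨n, rfl⟩ := h1
    rw [zpow_mul, zpow_natCast, hz]
    simp

end DegreeExists

/-! ## The loop algebra of `sl₂` and its highest-weight modules -/

attribute [local instance 100] LieRing.ofAssociativeRing

/-- The Lie algebra of traceless 2 × 2 matrices. -/
abbrev Sl2 (k : Type*) [Field k] := LieAlgebra.SpecialLinear.sl (Fin 2) k

/-- The element `e`, that is, the matrix unit `E₁₂`. -/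
def slE (k : Type*) [Field k] : Sl2 k := LieAlgebra.SpecialLinear.single 0 1 (by decide) 1

/-- The element `h = E₁₁ - E₂₂`. -/
def slH (k : Type*) [Field k] : Sl2 k := LieAlgebra.SpecialLinear.singleSubSingle 0 1 1

/-- The loop algebra `sl₂ ⊗ k[t, t⁻¹]` (with the Laurent polynomial written on the left). -/
abbrev Loop (k : Type*) [Field k] := k[T;T⁻¹] ⊗[k] Sl2 k

/-- The universal enveloping algebra of the loop algebra. -/
abbrev U (k : Type*) [Field k] := UniversalEnvelopingAlgebra k (Loop k)

/-- The element `x ⊗ a` of the loop algebra, inside the enveloping algebra. -/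
def el (x : Sl2 k) (a : k[T;T⁻¹]) : U k := UniversalEnvelopingAlgebra.ι k (a ⊗ₜ[k] x)

/-- The left ideal generated by the `e ⊗ a` and the `h ⊗ a - (a • φ)(0)`. -/
def indIdeal (φ : ℤ → k) : Submodule (U k) (U k) :=
  Submodule.span (U k) ({u | ∃ a, u = el (slE k) a} ∪
    {u | ∃ a, u = el (slH k) a - algebraMap k (U k) (act k a φ 0)})

/-- The module induced from the one-dimensional module `k v` of the subalgebra
`(h ⊗ k[t, t⁻¹]) + (e ⊗ k[t, t⁻¹])`, on which `h ⊗ a` acts by `(a • φ)(0)` and `e ⊗ a` by zero,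
as a quotient of the enveloping algebra; `v` is the class of `1`. -/
abbrev Ind (φ : ℤ → k) := U k ⧸ indIdeal φ

/-- The largest proper submodule of the induced module: the sum of all proper submodules. -/
def maxSub (φ : ℤ → k) : Submodule (U k) (Ind φ) := sSup {N | N ≠ ⊤}

/-- The irreducible highest-weight module `L(φ)`. -/
abbrev L (φ : ℤ → k) := Ind φ ⧸ maxSub φ

/-- The highest-weight vector of `L(φ)`. -/
def vac (φ : ℤ → k) : L φ := (maxSub φ).mkQ ((indIdeal φ).mkQ 1)

/-- The endomorphism of `L(φ)` by which `u` in the enveloping algebra acts. -/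
def actL (φ : ℤ → k) (u : U k) : Module.End k (L φ) := Module.toModuleEnd k (L φ) u

/-- The component of degree `n` of `L(φ)`: the weight space of weight `φ(0) α/2 - n α` for
`h = h ⊗ 1`, where `α(h) = 2`. -/
def gr (φ : ℤ → k) (n : ℕ) : Submodule k (L φ) :=
  (actL φ (el (slH k) 1)).eigenspace (φ 0 - 2 * n)

/-! ## The automorphism `η` -/

/-- The substitution `a(t) ↦ a(z t)` on Laurent polynomials. -/
def scale (z : kˣ) : k[T;T⁻¹] →ₐ[k] k[T;T⁻¹] :=
  AddMonoidAlgebra.lift k k[T;T⁻¹] ℤ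
    { toFun := fun n => ((z ^ n.toAdd : kˣ) : k) • T n.toAdd
      map_one' := by simp
      map_mul' := fun a b => by
        simp only [toAdd_mul, zpow_add, T_add, Units.val_mul, smul_mul_smul_comm] }

theorem scale_single (z : kˣ) (n : ℤ) (c : k) :
    scale z (AddMonoidAlgebra.single n c) =
      AddMonoidAlgebra.single n (c * ((z ^ n : kˣ) : k)) := by
  rw [scale, AddMonoidAlgebra.lift_single]
  change c • (((z ^ n : kˣ) : k) • AddMonoidAlgebra.single n (1 : k)) = _
  rw [AddMonoidAlgebra.smul_single, AddMonoidAlgebra.smul_single]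
  simp only [smul_eq_mul, mul_one]

theorem scale_comp (z w : kˣ) (a : k[T;T⁻¹]) : scale z (scale w a) = scale (z * w) a := by
  induction a using AddMonoidAlgebra.induction_linear with
  | zero => simp only [map_zero]
  | add a b ha hb => simp only [map_add, ha, hb]
  | single n c =>
    simp only [scale_single, mul_zpow, Units.val_mul]
    congr 1
    ring

theorem scale_one (a : k[T;T⁻¹]) : scale (1 : kˣ) a = a := by
  induction a using AddMonoidAlgebra.induction_linear with
  | zero => simp only [map_zero]
  | add a b ha hb => simp only [map_add, ha, hb]
  | single n c => simp only [scale_single, one_zpow, Units.val_one, mul_one]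

theorem act_scale {φ : ℤ → k} {z : kˣ} (hz : ∀ m : ℤ, ((z ^ m : kˣ) : k) * φ m = φ m)
    (a : k[T;T⁻¹]) : act k (scale z a) φ 0 = act k a φ 0 := by
  induction a using AddMonoidAlgebra.induction_linear with
  | zero => simp
  | add a b ha hb => simp only [map_add, LinearMap.add_apply, Pi.add_apply, ha, hb]
  | single n c =>
    rw [scale_single]
    simp only [act, AddMonoidAlgebra.lift_single, LinearMap.smul_apply, Pi.smul_apply, shift,
      MonoidHom.coe_mk, OneHom.coe_mk, LinearMap.coe_mk, AddHom.coe_mk, toAdd_ofAdd, zero_add,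
      smul_eq_mul, mul_assoc, hz]

/-- The endomorphism `x ⊗ a(t) ↦ x ⊗ a(z t)` of the enveloping algebra. -/
def twist (z : kˣ) : U k →ₐ[k] U k :=
  UniversalEnvelopingAlgebra.lift k
    ((UniversalEnvelopingAlgebra.ι k).comp
      (LieAlgebra.ExtendScalars.map (scale z) (LieHom.id : Sl2 k →ₗ⁅k⁆ Sl2 k)))

theorem twist_el (z : kˣ) (x : Sl2 k) (a : k[T;T⁻¹]) : twist z (el x a) = el x (scale z a) := by
  rw [twist, el, UniversalEnvelopingAlgebra.lift_ι_apply]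
  rfl

theorem algHom_ext_el {A B : U k →ₐ[k] U k} (hAB : ∀ x a, A (el x a) = B (el x a)) : A = B := by
  refine UniversalEnvelopingAlgebra.hom_ext k (LieHom.ext fun y => ?_)
  induction y using TensorProduct.induction_on with
  | zero => simp only [map_zero]
  | tmul a x => exact hAB x a
  | add y y' hy hy' => simp only [map_add, hy, hy']

theorem twist_twist (z w : kˣ) (u : U k) : twist z (twist w u) = twist (z * w) u := by
  have : (twist z).comp (twist w) = twist (z * w) :=
    algHom_ext_el fun x a => by
      simp [AlgHom.comp_apply, twist_el, scale_comp]
  exact DFunLike.congr_fun this u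

theorem twist_one (u : U k) : twist (1 : kˣ) u = u := by
  have : twist (1 : kˣ) = AlgHom.id k (U k) :=
    algHom_ext_el fun x a => by simp [twist_el, scale_one]
  exact DFunLike.congr_fun this u

/-- The condition on `φ` and `z` under which `twist z` descends to `L(φ)`. -/
def Compat (φ : ℤ → k) (z : kˣ) : Prop := ∀ m : ℤ, ((z ^ m : kˣ) : k) * φ m = φ m

theorem Compat.inv {φ : ℤ → k} {z : kˣ} (hz : Compat φ z) : Compat φ z⁻¹ := by
  intro m
  conv_lhs => rw [← hz m]
  rw [← mul_assoc, ← Units.val_mul, ← mul_zpow]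
  simp

theorem indIdeal_le {φ : ℤ → k} {z : kˣ} (hz : Compat φ z) :
    indIdeal φ ≤ (indIdeal φ).comap (twist z).toRingHom.toSemilinearMap := by
  rw [indIdeal, Submodule.span_le]
  rintro _ (⟨a, rfl⟩ | ⟨a, rfl⟩)
  · refine Submodule.subset_span (Or.inl ⟨scale z a, ?_⟩)
    exact twist_el z _ a
  · refine Submodule.subset_span (Or.inr ⟨scale z a, ?_⟩)
    rw [act_scale hz, ← twist_el]
    exact (map_sub (twist z) _ _).trans
      (congrArg (twist z (el (slH k) a) - ·) (AlgHom.commutes (twist z) _))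

/-- The map induced by `twist z` on the induced module. -/
def twistInd {φ : ℤ → k} {z : kˣ} (hz : Compat φ z) :
    Ind φ →ₛₗ[(twist z).toRingHom] Ind φ :=
  Submodule.mapQ _ _ (twist z).toRingHom.toSemilinearMap (indIdeal_le hz)

theorem twistInd_mk {φ : ℤ → k} {z : kˣ} (hz : Compat φ z) (u : U k) :
    twistInd hz (Submodule.Quotient.mk u) = Submodule.Quotient.mk (twist z u) := rfl

theorem twistInd_twistInd {φ : ℤ → k} {z w : kˣ} (hz : Compat φ z) (hw : Compat φ w)
    (hzw : z * w = 1) (m : Ind φ) : twistInd hz (twistInd hw m) = m := by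
  obtain ⟨u, rfl⟩ := Submodule.Quotient.mk_surjective _ m
  rw [twistInd_mk, twistInd_mk, twist_twist, hzw, twist_one]

theorem maxSub_le {φ : ℤ → k} {z : kˣ} (hz : Compat φ z) :
    maxSub φ ≤ (maxSub φ).comap (twistInd hz) := by
  refine sSup_le fun N hN m hm => ?_
  have hN' : N.comap (twistInd hz.inv) ≠ ⊤ := by
    intro htop
    refine hN (eq_top_iff.2 fun y _ => ?_)
    have h1 : twistInd hz y ∈ N.comap (twistInd hz.inv) := htop ▸ Submodule.mem_top
    rwa [Submodule.mem_comap, twistInd_twistInd hz.inv hz (inv_mul_cancel z)] at h1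
  refine (le_sSup hN' : N.comap (twistInd hz.inv) ≤ maxSub φ) ?_
  rwa [Submodule.mem_comap, twistInd_twistInd hz.inv hz (inv_mul_cancel z)]

/-- The map induced by `twist z` on `L(φ)`. -/
def twistL {φ : ℤ → k} {z : kˣ} (hz : Compat φ z) : L φ →ₛₗ[(twist z).toRingHom] L φ :=
  Submodule.mapQ _ _ (twistInd hz) (maxSub_le hz)

theorem twistL_twistL {φ : ℤ → k} {z w : kˣ} (hz : Compat φ z) (hw : Compat φ w)
    (hzw : z * w = 1) (m : L φ) : twistL hz (twistL hw m) = m := by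
  obtain ⟨u, rfl⟩ := Submodule.Quotient.mk_surjective _ m
  change Submodule.Quotient.mk (twistInd hz (twistInd hw u)) = _
  rw [twistInd_twistInd hz hw hzw]

theorem twistL_smul {φ : ℤ → k} {z : kˣ} (hz : Compat φ z) (c : k) (m : L φ) :
    twistL hz (c • m) = c • twistL hz m := by
  rw [← algebraMap_smul (U k) c m, LinearMap.map_smulₛₗ]
  change twist z (algebraMap k (U k) c) • _ = _
  rw [AlgHom.commutes, algebraMap_smul]

/-- The bijective `k`-linear form of `twistL`. -/
def twistEquiv {φ : ℤ → k} {z : kˣ} (hz : Compat φ z) : L φ ≃ₗ[k] L φ where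
  toFun := twistL hz
  map_add' := map_add _
  map_smul' := twistL_smul hz
  invFun := twistL hz.inv
  left_inv := twistL_twistL hz.inv hz (inv_mul_cancel z)
  right_inv := twistL_twistL hz hz.inv (mul_inv_cancel z)

/-- For a non-zero exponential-polynomial `φ` of degree `r` and `ζ ^ r = 1`, the automorphism `η`
of the vector space `L(φ)` that fixes the highest-weight vector and satisfies
`η ((x ⊗ a(t)) w) = (x ⊗ a(ζ⁻¹ t)) η(w)`; see `eta_vac`, `eta_smul`, `eta_unique`. -/
def eta {φ : ℤ → k} (hφ : φ ∈ expPoly k) (h0 : φ ≠ 0) {ζ : kˣ} (hζ : ζ ^ degree φ = 1) :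
    L φ ≃ₗ[k] L φ :=
  twistEquiv (Compat.inv (zpow_mul_eq hφ h0 hζ))

theorem eta_vac {φ : ℤ → k} (hφ : φ ∈ expPoly k) (h0 : φ ≠ 0) {ζ : kˣ}
    (hζ : ζ ^ degree φ = 1) : eta hφ h0 hζ (vac φ) = vac φ := by
  change Submodule.Quotient.mk (Submodule.Quotient.mk (twist ζ⁻¹ 1)) = _
  rw [map_one]
  rfl

theorem eta_smul {φ : ℤ → k} (hφ : φ ∈ expPoly k) (h0 : φ ≠ 0) {ζ : kˣ}
    (hζ : ζ ^ degree φ = 1) (x : Sl2 k) (a : k[T;T⁻¹]) (w : L φ) :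
    eta hφ h0 hζ (el x a • w) = el x (scale ζ⁻¹ a) • eta hφ h0 hζ w := by
  change twistL _ (el x a • w) = _
  rw [LinearMap.map_smulₛₗ]
  change twist ζ⁻¹ (el x a) • _ = _
  rw [twist_el]
  rfl

/-- `L(φ)` is spanned by the highest-weight vector under the enveloping algebra. -/
theorem exists_smul_vac (φ : ℤ → k) (w : L φ) : ∃ u : U k, w = u • vac φ := by
  obtain ⟨m, rfl⟩ := Submodule.Quotient.mk_surjective _ w
  obtain ⟨u, rfl⟩ := Submodule.Quotient.mk_surjective _ m
  refine ⟨u, ?_⟩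
  change (maxSub φ).mkQ ((indIdeal φ).mkQ u) = _
  rw [vac, ← map_smul, ← map_smul, smul_eq_mul, mul_one]

/-- The enveloping algebra is generated by the `x ⊗ a`. -/
theorem adjoin_el : Algebra.adjoin k {u : U k | ∃ x a, u = el x a} = ⊤ := by
  let S := Algebra.adjoin k {u : U k | ∃ x a, u = el x a}
  have hmem : ∀ y : Loop k, UniversalEnvelopingAlgebra.ι k y ∈ S := by
    intro y
    induction y using TensorProduct.induction_on with
    | zero => rw [map_zero]; exact S.zero_mem
    | tmul a x => exact Algebra.subset_adjoin ⟨x, a, rfl⟩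
    | add y y' hy hy' => rw [map_add]; exact S.add_mem hy hy'
  let g : Loop k →ₗ⁅k⁆ S :=
    { toFun := fun y => ⟨UniversalEnvelopingAlgebra.ι k y, hmem y⟩
      map_add' := fun y y' => Subtype.ext (map_add _ y y')
      map_smul' := fun c y => Subtype.ext (map_smul _ c y)
      map_lie' := fun {y y'} => Subtype.ext (LieHom.map_lie _ y y') }
  have hg : S.val.comp (UniversalEnvelopingAlgebra.lift k g) = AlgHom.id k (U k) :=
    algHom_ext_el fun x a => by
      rw [AlgHom.comp_apply, el, UniversalEnvelopingAlgebra.lift_ι_apply]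
      rfl
  refine eq_top_iff.2 fun u _ => ?_
  have := DFunLike.congr_fun hg u
  rw [AlgHom.comp_apply, AlgHom.id_apply] at this
  rw [← this]
  exact (UniversalEnvelopingAlgebra.lift k g u).2

/-- `eta` is determined by `eta_vac` and `eta_smul`. -/
theorem eta_unique {φ : ℤ → k} (hφ : φ ∈ expPoly k) (h0 : φ ≠ 0) {ζ : kˣ}
    (hζ : ζ ^ degree φ = 1) (g : L φ →ₗ[k] L φ) (hg : g (vac φ) = vac φ)
    (hg' : ∀ (x : Sl2 k) (a : k[T;T⁻¹]) (w : L φ), g (el x a • w) = el x (scale ζ⁻¹ a) • g w) :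
    g = (eta hφ h0 hζ).toLinearMap := by
  have key : ∀ u : U k, ∀ w, g w = eta hφ h0 hζ w → g (u • w) = eta hφ h0 hζ (u • w) := by
    intro u
    have hu : u ∈ Algebra.adjoin k {u : U k | ∃ x a, u = el x a} := by
      rw [adjoin_el]
      exact Algebra.mem_top
    induction hu using Algebra.adjoin_induction with
    | mem u hu =>
      obtain ⟨x, a, rfl⟩ := hu
      intro w hw
      rw [hg', eta_smul, hw]
    | algebraMap c =>
      intro w hw
      rw [algebraMap_smul, map_smul, map_smul, hw]
    | add u v _ _ hu hv =>
      intro w hw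
      rw [add_smul, map_add, map_add, hu w hw, hv w hw]
    | mul u v _ _ hu hv =>
      intro w hw
      rw [mul_smul]
      exact hu _ (hv w hw)
  refine LinearMap.ext fun w => ?_
  obtain ⟨u, rfl⟩ := exists_smul_vac φ w
  exact key u _ (by rw [hg, eta_vac])

/-! ## Graded vector spaces and tensor powers -/

section Graded

variable {V : Type*} [AddCommGroup V] [Module k V]

/-- `V` is the direct sum of the finite-dimensional subspaces `G n`, `n ≥ 0`. -/
def IsNatGrading (G : ℕ → Submodule k V) : Prop :=
  DirectSum.IsInternal G ∧ ∀ n, FiniteDimensional k (G n)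

/-- The `r`-th tensor power. -/
abbrev TPow (k : Type*) [Field k] (V : Type*) [AddCommGroup V] [Module k V] (r : ℕ) :=
  ⨂[k] _ : Fin r, V

/-- The component of degree `n` of the `r`-th tensor power: the sum of the
`G (d 1) ⊗ ⋯ ⊗ G (d r)` with `d 1 + ⋯ + d r = n`. -/
def tpowGr (G : ℕ → Submodule k V) (r n : ℕ) : Submodule k (TPow k V r) :=
  ⨆ d ∈ {d : Fin r → ℕ | ∑ i, d i = n},
    Submodule.span k {x | ∃ v : Fin r → V, (∀ i, v i ∈ G (d i)) ∧ x = PiTensorProduct.tprod k v}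

/-- The cyclic permutation `v₁ ⊗ ⋯ ⊗ vᵣ ↦ vᵣ ⊗ v₁ ⊗ ⋯ ⊗ vᵣ₋₁` of the tensor factors. -/
def cyc (k : Type*) [Field k] (V : Type*) [AddCommGroup V] [Module k V] (r : ℕ) :
    TPow k V r ≃ₗ[k] TPow k V r :=
  PiTensorProduct.reindex k (fun _ => V) (finRotate r)

theorem cyc_tprod (r : ℕ) (v : Fin r → V) :
    cyc k V r (PiTensorProduct.tprod k v) =
      PiTensorProduct.tprod k fun i => v ((finRotate r).symm i) :=
  PiTensorProduct.reindex_tprod _ _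

end Graded

/-- `φ = κ_r ψ`, and `∏_{i < r} c_ψ(ζ ^ i t)` is, up to a non-zero scalar, a decomposition of
`c_φ` into pairwise coprime factors, where `c` denotes characteristic polynomials. -/
structure IsExpression (φ ψ : ℤ → k) (r : ℕ) (ζ : kˣ) : Prop where
  eq_mul : ∀ m, φ m = kron k r m * ψ m
  associated : Associated (charPoly φ)
    (∏ i ∈ Finset.range r, (charPoly ψ).comp (Polynomial.C ((ζ : k) ^ i) * X))
  coprime : ∀ i < r, ∀ j < r, i ≠ j →
    IsCoprime ((charPoly ψ).comp (Polynomial.C ((ζ : k) ^ i) * X)) ((charPoly ψ).comp (Polynomial.C ((ζ : k) ^ j) * X))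

end LoopSl2

end

/-! `L(φ)` can be recognised by a functional. Let `eps` take `u` to the coefficient of the
highest-weight vector `v` in `u v`. It is constructed on a polynomial ring in variables `Xₙ`, in
place of the Poincaré–Birkhoff–Witt theorem: `f ⊗ tⁿ` is multiplication by `Xₙ`, `v` is `1`, and the
operators for `h ⊗ a` and `e ⊗ a` are then forced. In characteristic zero a polynomial in `h ⊗ 1`
projects any vector to a non-zero multiple of its `v`-component, so a submodule of the induced
module is proper exactly when this component vanishes on it (`maxSub_eq`). Hence a module generated
by a vector of highest weight `φ` is `L(φ)` as soon as it carries a functional that is `1` on that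
vector, vanishes on the images of the `f ⊗ a` and has no non-zero submodule in its kernel
(`exists_equiv_of_isHighestWeight`).

Let `x ⊗ a` act on `L(ψ)^{⊗r}` as the sum over `0 ≤ i < r` of `x ⊗ a(ζⁱt)` on the `i`-th factor.
Then `v ⊗ ⋯ ⊗ v` has highest weight `κ_r ψ = φ` (`ev_scale_sum`). Since `x ⊗ b` kills `L(ψ)`
whenever `b` kills `ψ` (`el_smul_eq_zero`), only residues modulo `c_ψ` matter. As the `c_ψ(ζⁱt)` are
coprime, the Chinese remainder theorem (`exists_scale_congr`) shows that the action on each single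
factor comes from the enveloping algebra (`atPos_mem_range`). So `v ⊗ ⋯ ⊗ v` generates, the tensor
power of the functional remains non-degenerate, and the tensor power is `L(φ)`.

Rotating the factors fixes `v ⊗ ⋯ ⊗ v` and turns `x ⊗ a(t)` into `x ⊗ a(ζ⁻¹t)`, which characterises
`eta` (`eta_unique`). Both gradings are by eigenvalues of `h ⊗ 1`, and weights add in tensor
products. The components are finite-dimensional because `f ⊗ a` depends only on `a` modulo the
annihilator of `φ`, which has finite codimension. -/

noncomputable section

namespace LoopSl2

open Polynomial LaurentPolynomial TensorProduct

variable {k : Type*} [Field k]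

attribute [local instance 100] LieRing.ofAssociativeRing

/-! ## The functional `a ↦ (a • φ)(0)` and relations in the enveloping algebra -/

/-- The functional `a ↦ (a • φ)(0)` on Laurent polynomials. -/
def ev (φ : ℤ → k) : k[T;T⁻¹] →ₗ[k] k :=
  (LinearMap.proj 0 ∘ₗ LinearMap.applyₗ φ) ∘ₗ (act k).toLinearMap

theorem ev_apply (φ : ℤ → k) (a : k[T;T⁻¹]) : ev φ a = act k a φ 0 := rfl

theorem act_T (φ : ℤ → k) (n m : ℤ) : act k (T n) φ m = φ (m + n) := by
  rw [act, T, AddMonoidAlgebra.lift_single, one_smul]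
  rfl

theorem ev_T (φ : ℤ → k) (n : ℤ) : ev φ (T n) = φ n := by
  rw [ev_apply, act_T, zero_add]

theorem ev_one (φ : ℤ → k) : ev φ 1 = φ 0 := by
  rw [← T_zero, ev_T]

theorem ev_mul_of_act_eq_zero {φ : ℤ → k} {b : k[T;T⁻¹]} (hb : act k b φ = 0) (a : k[T;T⁻¹]) :
    ev φ (a * b) = 0 := by
  rw [ev_apply, map_mul, Module.End.mul_apply, hb, map_zero]
  rfl

/-- Linear maps on Laurent polynomials agree if they agree on powers of `T`. -/
theorem laurent_hom_ext {M : Type*} [AddCommGroup M] [Module k M] {f g : k[T;T⁻¹] →ₗ[k] M}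
    (h : ∀ n : ℤ, f (T n) = g (T n)) : f = g := by
  refine LinearMap.ext fun a => ?_
  induction a using AddMonoidAlgebra.induction_linear with
  | zero => simp only [map_zero]
  | add a b ha hb => simp only [map_add, ha, hb]
  | single n c =>
    have : (AddMonoidAlgebra.single n c : k[T;T⁻¹]) = c • T n := by
      rw [T, AddMonoidAlgebra.smul_single, smul_eq_mul, mul_one]
    rw [this, map_smul, map_smul, h]

/-- The element `f = E₂₁`. -/
def slF (k : Type*) [Field k] : Sl2 k := LieAlgebra.SpecialLinear.single 1 0 (by decide) 1

theorem lie_slH_slF : ⁅slH k, slF k⁆ = (-2 : k) • slF k := by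
  refine Subtype.ext ?_
  ext i j
  fin_cases i <;> fin_cases j <;>
    (simp [slH, slF, LieRing.of_associative_ring_bracket, Matrix.mul_apply]; try norm_num)

theorem lie_slE_slF : ⁅slE k, slF k⁆ = slH k := by
  refine Subtype.ext ?_
  ext i j
  fin_cases i <;> fin_cases j <;>
    simp [slH, slE, slF, LieRing.of_associative_ring_bracket]

theorem sl2_eq (x : Sl2 k) :
    x = (x.1 0 1) • slE k + (x.1 0 0) • slH k + (x.1 1 0) • slF k := by
  have ht : x.1 0 0 + x.1 1 1 = 0 := by
    have h1 : Matrix.trace x.1 = 0 := x.2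
    rwa [Matrix.trace_fin_two] at h1
  refine Subtype.ext ?_
  ext i j
  fin_cases i <;> fin_cases j <;> simp [slE, slF, slH]
  -- Only the lower right entry is left; this is where tracelessness enters.
  linear_combination ht

/-- `a ↦ x ⊗ a` as a linear map. -/
def elL (x : Sl2 k) : k[T;T⁻¹] →ₗ[k] U k where
  toFun := el x
  map_add' a b := by simp only [el, add_tmul, map_add]
  map_smul' c a := by simp only [el, ← smul_tmul', map_smul, RingHom.id_apply]

theorem elL_apply (x : Sl2 k) (a : k[T;T⁻¹]) : elL x a = el x a := rfl

theorem el_add_left (x y : Sl2 k) (a : k[T;T⁻¹]) : el (x + y) a = el x a + el y a := by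
  simp only [el, tmul_add, map_add]

theorem el_smul_left (c : k) (x : Sl2 k) (a : k[T;T⁻¹]) : el (c • x) a = c • el x a := by
  simp only [el, tmul_smul, map_smul]

theorem el_mul_sub (x y : Sl2 k) (a b : k[T;T⁻¹]) :
    el x a * el y b - el y b * el x a = el ⁅x, y⁆ (a * b) := by
  rw [el, el, el, ← LieAlgebra.ExtendScalars.bracket_tmul, LieHom.map_lie,
    LieRing.of_associative_ring_bracket]

theorem el_mul (x y : Sl2 k) (a b : k[T;T⁻¹]) :
    el x a * el y b = el y b * el x a + el ⁅x, y⁆ (a * b) := by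
  rw [← el_mul_sub]
  abel

theorem el_decomp (x : Sl2 k) (a : k[T;T⁻¹]) :
    el x a = (x.1 0 1) • el (slE k) a + (x.1 0 0) • el (slH k) a + (x.1 1 0) • el (slF k) a := by
  conv_lhs => rw [sl2_eq x]
  rw [el_add_left, el_add_left, el_smul_left, el_smul_left, el_smul_left]

/-- Induction along the generators `x ⊗ a` of the enveloping algebra. -/
theorem u_induction {p : U k → Prop} (hel : ∀ x a, p (el x a))
    (hc : ∀ c, p (algebraMap k (U k) c)) (hadd : ∀ u v, p u → p v → p (u + v))
    (hmul : ∀ u v, p u → p v → p (u * v)) (u : U k) : p u := by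
  have hu : u ∈ Algebra.adjoin k {u : U k | ∃ x a, u = el x a} := by
    rw [adjoin_el]
    exact Algebra.mem_top
  induction hu using Algebra.adjoin_induction with
  | mem u hu =>
    obtain ⟨x, a, rfl⟩ := hu
    exact hel x a
  | algebraMap c => exact hc c
  | add u v _ _ hu hv => exact hadd u v hu hv
  | mul u v _ _ hu hv => exact hmul u v hu hv

/-! ## The polynomial realisation of the induced module -/

section Verma

/-- Polynomials in variables indexed by the integers, the underlying space of the realisation. -/
abbrev Pol (k : Type*) [Field k] := MvPolynomial ℤ k

/-- The linear form `∑ aₙ Xₙ` attached to the Laurent polynomial `∑ aₙ tⁿ`. -/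
def linForm (k : Type*) [Field k] : k[T;T⁻¹] →ₗ[k] Pol k :=
  Finsupp.linearCombination k (fun n : ℤ => (MvPolynomial.X n : Pol k)) ∘ₗ
    (AddMonoidAlgebra.coeffLinearEquiv k).toLinearMap

theorem linForm_T (n : ℤ) : linForm k (T n) = MvPolynomial.X n := by
  change Finsupp.linearCombination k (fun n : ℤ => (MvPolynomial.X n : Pol k))
    (Finsupp.single n 1) = _
  rw [Finsupp.linearCombination_single, one_smul]

/-- The derivation with `Xₘ ↦ ∑ aₙ Xₘ₊ₙ`. -/
def derD (a : k[T;T⁻¹]) : Derivation k (Pol k) (Pol k) :=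
  MvPolynomial.mkDerivation k fun m => linForm k (a * T m)

/-- The derivation with `Xₘ ↦ ∑ aₙ φ(m + n)`. -/
def derG (φ : ℤ → k) (a : k[T;T⁻¹]) : Derivation k (Pol k) (Pol k) :=
  MvPolynomial.mkDerivation k fun m => MvPolynomial.C (ev φ (a * T m))

/-- The universal derivation of the polynomial ring. -/
def derU (k : Type*) [Field k] : Derivation k (Pol k) (ℤ →₀ Pol k) :=
  MvPolynomial.mkDerivation k fun m => Finsupp.single m 1

/-- The second-order operator `∑ aₙ Xₙ₊ₘ₊ₗ ∂ₘ ∂ₗ`. -/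
def opQ (a : k[T;T⁻¹]) : Pol k →ₗ[k] Pol k :=
  (Finsupp.lsum k fun m : ℤ => (derD (a * T m)).toLinearMap) ∘ₗ (derU k).toLinearMap

theorem derD_X (a : k[T;T⁻¹]) (m : ℤ) : derD a (MvPolynomial.X m) = linForm k (a * T m) :=
  MvPolynomial.mkDerivation_X _ _ _

theorem derD_add (a b : k[T;T⁻¹]) : derD (a + b) = derD a + derD b :=
  MvPolynomial.derivation_ext fun m => by
    simp only [derD_X, Derivation.add_apply, add_mul, map_add]

theorem derD_smul (c : k) (a : k[T;T⁻¹]) : derD (c • a) = c • derD a :=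
  MvPolynomial.derivation_ext fun m => by
    simp only [derD_X, Derivation.smul_apply, smul_mul_assoc, map_smul]

theorem derG_X (φ : ℤ → k) (a : k[T;T⁻¹]) (m : ℤ) :
    derG φ a (MvPolynomial.X m) = MvPolynomial.C (ev φ (a * T m)) :=
  MvPolynomial.mkDerivation_X _ _ _

theorem derG_add (φ : ℤ → k) (a b : k[T;T⁻¹]) : derG φ (a + b) = derG φ a + derG φ b :=
  MvPolynomial.derivation_ext fun m => by
    simp only [derG_X, Derivation.add_apply, add_mul, map_add]

theorem derG_smul (φ : ℤ → k) (c : k) (a : k[T;T⁻¹]) : derG φ (c • a) = c • derG φ a :=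
  MvPolynomial.derivation_ext fun m => by
    simp only [derG_X, Derivation.smul_apply, smul_mul_assoc, map_smul, MvPolynomial.smul_eq_C_mul,
      smul_eq_mul, map_mul]

theorem opQ_add (a b : k[T;T⁻¹]) : opQ (a + b) = opQ a + opQ b := by
  refine LinearMap.ext fun p => ?_
  simp only [opQ, LinearMap.comp_apply, LinearMap.add_apply, Finsupp.lsum_apply, add_mul, derD_add]
  exact Finsupp.sum_add

theorem opQ_smul (c : k) (a : k[T;T⁻¹]) : opQ (c • a) = c • opQ a := by
  refine LinearMap.ext fun p => ?_
  simp only [opQ, LinearMap.comp_apply, LinearMap.smul_apply, Finsupp.lsum_apply, smul_mul_assoc,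
    derD_smul]
  rw [Finsupp.smul_sum]
  rfl

/-- A derivation is the combination of the partial derivatives weighted by its values on the
variables. -/
theorem linearCombination_derU (a : k[T;T⁻¹]) (p : Pol k) :
    Finsupp.linearCombination (Pol k) (fun m : ℤ => linForm k (a * T m)) (derU k p) = derD a p := by
  have : (Finsupp.linearCombination (Pol k) (fun m : ℤ => linForm k (a * T m))).compDer (derU k) =
      derD a :=
    MvPolynomial.derivation_ext fun m => by
      rw [derD_X]
      simp [derU, MvPolynomial.mkDerivation_X]
  exact DFunLike.congr_fun this p

/-- The factor `2` appears because either of the two derivatives in `opQ` may fall on `Xₘ`, and the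
operator is symmetric in them. -/
theorem opQ_X_mul (a : k[T;T⁻¹]) (m : ℤ) (p : Pol k) :
    opQ a (MvPolynomial.X m * p) = MvPolynomial.X m * opQ a p + 2 * derD (a * T m) p := by
  have key : ∀ g : ℤ →₀ Pol k, (Finsupp.lsum k fun l : ℤ => (derD (a * T l)).toLinearMap)
      ((MvPolynomial.X m : Pol k) • g) =
      MvPolynomial.X m * (Finsupp.lsum k fun l : ℤ => (derD (a * T l)).toLinearMap) g +
        Finsupp.linearCombination (Pol k) (fun l : ℤ => linForm k (a * T m * T l)) g := by
    intro g
    induction g using Finsupp.induction_linear with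
    | zero => simp
    | add g g' hg hg' =>
      rw [smul_add, map_add, hg, hg', map_add, map_add]
      ring
    | single l q =>
      rw [Finsupp.smul_single]
      simp only [Finsupp.lsum_single, Finsupp.linearCombination_single, smul_eq_mul,
        Derivation.coeFn_coe, Derivation.leibniz, derD_X]
      rw [show a * T l * T m = a * T m * T l by ring]
  have h1 : derU k (MvPolynomial.X m * p) =
      (MvPolynomial.X m : Pol k) • derU k p + Finsupp.single m p := by
    rw [Derivation.leibniz, derU, MvPolynomial.mkDerivation_X, Finsupp.smul_single, smul_eq_mul,
      mul_one]
  rw [opQ, LinearMap.comp_apply, LinearMap.comp_apply]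
  simp only [Derivation.coeFn_coe]
  rw [h1, map_add, key, linearCombination_derU, Finsupp.lsum_single, Derivation.coeFn_coe]
  ring

/-- The operator by which `f ⊗ a` acts. -/
def opF : k[T;T⁻¹] →ₗ[k] Module.End k (Pol k) :=
  (LinearMap.mul k (Pol k)) ∘ₗ linForm k

/-- The operator by which `h ⊗ a` acts. -/
def opH (φ : ℤ → k) : k[T;T⁻¹] →ₗ[k] Module.End k (Pol k) where
  toFun a := ev φ a • LinearMap.id - (2 : k) • (derD a).toLinearMap
  map_add' a b := by
    rw [map_add, derD_add, add_smul, Derivation.coe_add_linearMap, smul_add]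
    abel
  map_smul' c a := by
    rw [map_smul, derD_smul, Derivation.coe_smul_linearMap, RingHom.id_apply, smul_sub, smul_assoc,
      smul_comm c (2 : k)]

/-- The operator by which `e ⊗ a` acts. -/
def opE (φ : ℤ → k) : k[T;T⁻¹] →ₗ[k] Module.End k (Pol k) where
  toFun a := (derG φ a).toLinearMap - opQ a
  map_add' a b := by
    rw [derG_add, opQ_add, Derivation.coe_add_linearMap]
    abel
  map_smul' c a := by
    rw [derG_smul, opQ_smul, Derivation.coe_smul_linearMap, RingHom.id_apply, smul_sub]

theorem opF_apply (a : k[T;T⁻¹]) (p : Pol k) : opF a p = linForm k a * p := rfl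

theorem opH_apply (φ : ℤ → k) (a : k[T;T⁻¹]) (p : Pol k) :
    opH φ a p = ev φ a • p - (2 : k) • derD a p := rfl

theorem opE_apply (φ : ℤ → k) (a : k[T;T⁻¹]) (p : Pol k) :
    opE φ a p = derG φ a p - opQ a p := rfl

theorem opH_one (φ : ℤ → k) (a : k[T;T⁻¹]) : opH φ a 1 = ev φ a • 1 := by
  rw [opH_apply, Derivation.map_one_eq_zero, smul_zero, sub_zero]

theorem opE_one (φ : ℤ → k) (a : k[T;T⁻¹]) : opE φ a 1 = 0 := by
  rw [opE_apply, Derivation.map_one_eq_zero, opQ, LinearMap.comp_apply, Derivation.coeFn_coe,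
    Derivation.map_one_eq_zero, map_zero, sub_zero]

theorem opH_X_mul (φ : ℤ → k) (a : k[T;T⁻¹]) (m : ℤ) (p : Pol k) :
    opH φ a (MvPolynomial.X m * p) =
      MvPolynomial.X m * opH φ a p - (2 : k) • (linForm k (a * T m) * p) := by
  simp only [opH_apply, Derivation.leibniz, derD_X, smul_eq_mul, MvPolynomial.smul_eq_C_mul]
  ring

/-- This is the relation `[e ⊗ a, f ⊗ tᵐ] = h ⊗ a tᵐ`. Together with `opE_one` it determines `opE`,
and so dictates the shape of `derG` and `opQ`. -/
theorem opE_X_mul (φ : ℤ → k) (a : k[T;T⁻¹]) (m : ℤ) (p : Pol k) :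
    opE φ a (MvPolynomial.X m * p) = MvPolynomial.X m * opE φ a p + opH φ (a * T m) p := by
  simp only [opE_apply, opH_apply, Derivation.leibniz, derG_X, opQ_X_mul, smul_eq_mul,
    MvPolynomial.smul_eq_C_mul, map_ofNat]
  ring

theorem opH_linForm_mul (φ : ℤ → k) (a b : k[T;T⁻¹]) (p : Pol k) :
    opH φ a (linForm k b * p) =
      linForm k b * opH φ a p - (2 : k) • (linForm k (a * b) * p) := by
  have : (opH φ a) ∘ₗ (LinearMap.mul k (Pol k)).flip p ∘ₗ linForm k =
      (LinearMap.mul k (Pol k)).flip (opH φ a p) ∘ₗ linForm k -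
        (2 : k) • ((LinearMap.mul k (Pol k)).flip p ∘ₗ linForm k ∘ₗ LinearMap.mulLeft k a) :=
    laurent_hom_ext fun n => by
      simp only [LinearMap.comp_apply, LinearMap.sub_apply, LinearMap.smul_apply,
        LinearMap.flip_apply, LinearMap.mul_apply', linForm_T, LinearMap.mulLeft_apply, opH_X_mul]
  exact DFunLike.congr_fun this b

theorem opE_linForm_mul (φ : ℤ → k) (a b : k[T;T⁻¹]) (p : Pol k) :
    opE φ a (linForm k b * p) = linForm k b * opE φ a p + opH φ (a * b) p := by
  have : (opE φ a) ∘ₗ (LinearMap.mul k (Pol k)).flip p ∘ₗ linForm k =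
      (LinearMap.mul k (Pol k)).flip (opE φ a p) ∘ₗ linForm k +
        (LinearMap.applyₗ p ∘ₗ opH φ) ∘ₗ LinearMap.mulLeft k a :=
    laurent_hom_ext fun n => by
      simp only [LinearMap.comp_apply, LinearMap.add_apply, LinearMap.applyₗ_apply_apply,
        LinearMap.flip_apply, LinearMap.mul_apply', linForm_T, LinearMap.mulLeft_apply, opE_X_mul]
  exact DFunLike.congr_fun this b

/-- An operator that kills `1` and commutes with the variables vanishes. -/
theorem pol_op_eq_zero {A : Pol k →ₗ[k] Pol k} (h1 : A 1 = 0)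
    (hX : ∀ m p, A (MvPolynomial.X m * p) = MvPolynomial.X m * A p) (p : Pol k) : A p = 0 := by
  induction p using MvPolynomial.induction_on with
  | C c => rw [MvPolynomial.C_eq_smul_one, map_smul, h1, smul_zero]
  | add p q hp hq => rw [map_add, hp, hq, add_zero]
  | mul_X p n hp => rw [mul_comm, hX, hp, mul_zero]

theorem opF_opF (a b : k[T;T⁻¹]) : opF a * opF b - opF b * opF a = 0 := by
  refine LinearMap.ext fun p => ?_
  simp only [LinearMap.sub_apply, Module.End.mul_apply, opF_apply, LinearMap.zero_apply]
  ring

theorem opH_opF (φ : ℤ → k) (a b : k[T;T⁻¹]) :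
    opH φ a * opF b - opF b * opH φ a = (-2 : k) • opF (a * b) := by
  refine LinearMap.ext fun p => ?_
  simp only [LinearMap.sub_apply, Module.End.mul_apply, opF_apply, opH_linForm_mul,
    LinearMap.smul_apply, neg_smul]
  ring

theorem opE_opF (φ : ℤ → k) (a b : k[T;T⁻¹]) :
    opE φ a * opF b - opF b * opE φ a = opH φ (a * b) := by
  refine LinearMap.ext fun p => ?_
  simp only [LinearMap.sub_apply, Module.End.mul_apply, opF_apply, opE_linForm_mul]
  ring

/-- This relation and the next two are tested with `pol_op_eq_zero`. Commuting the defect past a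
variable yields defects of relations already known, in the order `h`–`h`, `h`–`e`, `e`–`e`. -/
theorem opH_opH (φ : ℤ → k) (a b : k[T;T⁻¹]) :
    opH φ a * opH φ b - opH φ b * opH φ a = 0 := by
  refine LinearMap.ext fun p => pol_op_eq_zero ?_ ?_ p
  · simp only [LinearMap.sub_apply, Module.End.mul_apply, opH_one, map_smul]
    rw [smul_comm, sub_self]
  · intro m p
    simp only [LinearMap.sub_apply, Module.End.mul_apply, opH_X_mul, opH_linForm_mul, map_sub,
      map_smul]
    rw [show b * (a * T m) = a * (b * T m) by ring]
    simp only [MvPolynomial.smul_eq_C_mul]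
    ring

theorem opH_opE (φ : ℤ → k) (a b : k[T;T⁻¹]) :
    opH φ a * opE φ b - opE φ b * opH φ a = (2 : k) • opE φ (a * b) := by
  rw [← sub_eq_zero]
  refine LinearMap.ext fun p => pol_op_eq_zero ?_ ?_ p
  · simp only [LinearMap.sub_apply, Module.End.mul_apply, LinearMap.smul_apply, opH_one, opE_one,
      map_smul, map_zero, smul_zero, sub_zero]
  · intro m p
    have h1 := LinearMap.congr_fun (opH_opH φ a (b * T m)) p
    simp only [LinearMap.sub_apply, Module.End.mul_apply, LinearMap.zero_apply] at h1
    simp only [LinearMap.sub_apply, Module.End.mul_apply, LinearMap.smul_apply, opH_X_mul,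
      opE_X_mul, opE_linForm_mul, map_sub, map_smul, map_add]
    rw [show b * (a * T m) = a * b * T m by ring]
    simp only [MvPolynomial.smul_eq_C_mul]
    linear_combination h1

theorem opE_opE (φ : ℤ → k) (a b : k[T;T⁻¹]) :
    opE φ a * opE φ b - opE φ b * opE φ a = 0 := by
  refine LinearMap.ext fun p => pol_op_eq_zero ?_ ?_ p
  · simp only [LinearMap.sub_apply, Module.End.mul_apply, opE_one, map_zero, sub_zero]
  · intro m p
    have h1 := LinearMap.congr_fun (opH_opE φ (a * T m) b) p
    have h2 := LinearMap.congr_fun (opH_opE φ (b * T m) a) p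
    rw [show b * T m * a = a * T m * b by ring] at h2
    simp only [LinearMap.sub_apply, Module.End.mul_apply] at h1 h2
    simp only [LinearMap.sub_apply, Module.End.mul_apply, opE_X_mul, map_add]
    linear_combination h1 - h2

theorem coe_sl2_add (x y : Sl2 k) : (x + y).1 = x.1 + y.1 := rfl

theorem coe_sl2_smul (c : k) (x : Sl2 k) : (c • x).1 = c • x.1 := rfl

/-- The linear map by which the loop algebra acts on polynomials. -/
def polLin (φ : ℤ → k) : Loop k →ₗ[k] Module.End k (Pol k) :=
  TensorProduct.lift <| LinearMap.mk₂ k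
    (fun (a : k[T;T⁻¹]) (x : Sl2 k) =>
      (x.1 0 1) • opE φ a + (x.1 0 0) • opH φ a + (x.1 1 0) • opF a)
    (fun a b x => by simp only [map_add, smul_add]; abel)
    (fun c a x => by
      simp only [map_smul, smul_add]
      rw [smul_comm c, smul_comm c, smul_comm c])
    (fun a x y => by
      rw [coe_sl2_add]
      simp only [Matrix.add_apply, add_smul]
      abel)
    (fun c a x => by
      rw [coe_sl2_smul]
      simp only [Matrix.smul_apply, smul_eq_mul, mul_smul, smul_add])

theorem polLin_tmul (φ : ℤ → k) (a : k[T;T⁻¹]) (x : Sl2 k) : polLin φ (a ⊗ₜ x) =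
    (x.1 0 1) • opE φ a + (x.1 0 0) • opH φ a + (x.1 1 0) • opF a := rfl

theorem polLin_lie_tmul (φ : ℤ → k) (a b : k[T;T⁻¹]) (x y : Sl2 k) :
    polLin φ ⁅a ⊗ₜ[k] x, b ⊗ₜ[k] y⁆ =
      polLin φ (a ⊗ₜ x) * polLin φ (b ⊗ₜ y) - polLin φ (b ⊗ₜ y) * polLin φ (a ⊗ₜ x) := by
  have hx : x.1 1 1 = - x.1 0 0 := by
    have h1 : Matrix.trace x.1 = 0 := x.2
    rw [Matrix.trace_fin_two] at h1
    linear_combination h1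
  have hy : y.1 1 1 = - y.1 0 0 := by
    have h1 : Matrix.trace y.1 = 0 := y.2
    rw [Matrix.trace_fin_two] at h1
    linear_combination h1
  -- The brackets with `a` and `b` exchanged also occur; `b * a` is rewritten so that their
  -- right-hand sides match.
  have hFE := opE_opF φ b a
  have hFH := opH_opF φ b a
  have hEH := opH_opE φ b a
  rw [mul_comm b a] at hFE hFH hEH
  have hxy : (⁅x, y⁆ : Sl2 k).1 = x.1 * y.1 - y.1 * x.1 := by
    rw [← LieRing.of_associative_ring_bracket]
    rfl
  rw [LieAlgebra.ExtendScalars.bracket_tmul, polLin_tmul, polLin_tmul, polLin_tmul, hxy]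
  simp only [Matrix.sub_apply, Matrix.mul_apply, Fin.sum_univ_two, hx, hy, add_mul, mul_add,
    smul_mul_smul_comm]
  -- Normal ordering: `f` to the left of `e` to the left of `h`, and `b` to the left of `a` within
  -- one type. What remains is a linear identity between ordered products.
  have e1 := sub_eq_iff_eq_add.1 (opE_opE φ a b)
  have e2 := sub_eq_iff_eq_add.1 (opH_opH φ a b)
  have e3 := sub_eq_iff_eq_add.1 (opF_opF (k := k) a b)
  have e4 := sub_eq_iff_eq_add.1 (opE_opF φ a b)
  have e5 := sub_eq_iff_eq_add.1 (opH_opF φ a b)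
  have e6 := sub_eq_iff_eq_add.1 (opH_opE φ a b)
  have e7 := sub_eq_iff_eq_add.1 hFE
  have e8 := sub_eq_iff_eq_add.1 hFH
  have e9 := sub_eq_iff_eq_add.1 hEH
  rw [e1, e2, e3, e4, e5, e6, e7, e8, e9]
  module

/-- The action of the loop algebra on polynomials. -/
def polLie (φ : ℤ → k) : Loop k →ₗ⁅k⁆ Module.End k (Pol k) where
  __ := polLin φ
  map_lie' {y z} := by
    change polLin φ ⁅y, z⁆ = ⁅polLin φ y, polLin φ z⁆
    rw [LieRing.of_associative_ring_bracket]
    induction y using TensorProduct.induction_on with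
    | zero =>
      refine (congrArg (polLin φ) (zero_lie z)).trans ?_
      simp only [map_zero, zero_mul, mul_zero, sub_zero]
    | add y y' hy hy' =>
      refine (congrArg (polLin φ) (add_lie y y' z)).trans ?_
      rw [map_add, hy, hy', map_add]
      noncomm_ring
    | tmul a x =>
      induction z using TensorProduct.induction_on with
      | zero =>
        refine (congrArg (polLin φ) (lie_zero (a ⊗ₜ[k] x))).trans ?_
        simp only [map_zero, zero_mul, mul_zero, sub_zero]
      | add z z' hz hz' =>
        refine (congrArg (polLin φ) (lie_add (a ⊗ₜ[k] x) z z')).trans ?_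
        rw [map_add, hz, hz', map_add]
        noncomm_ring
      | tmul b y => exact polLin_lie_tmul φ a b x y

/-- The action of the enveloping algebra on polynomials. -/
def polRep (φ : ℤ → k) : U k →ₐ[k] Module.End k (Pol k) :=
  UniversalEnvelopingAlgebra.lift k (polLie φ)

theorem polRep_el (φ : ℤ → k) (x : Sl2 k) (a : k[T;T⁻¹]) : polRep φ (el x a) =
    (x.1 0 1) • opE φ a + (x.1 0 0) • opH φ a + (x.1 1 0) • opF a := by
  rw [polRep, el, UniversalEnvelopingAlgebra.lift_ι_apply]
  rfl

theorem polRep_slE (φ : ℤ → k) (a : k[T;T⁻¹]) : polRep φ (el (slE k) a) = opE φ a := by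
  rw [polRep_el]
  simp [slE]

theorem polRep_slH (φ : ℤ → k) (a : k[T;T⁻¹]) : polRep φ (el (slH k) a) = opH φ a := by
  rw [polRep_el]
  simp [slH]

theorem polRep_slF (φ : ℤ → k) (a : k[T;T⁻¹]) : polRep φ (el (slF k) a) = opF a := by
  rw [polRep_el]
  simp [slF]

/-- The functional on the enveloping algebra that takes `u` to the coefficient of the
highest-weight vector `v` in `u v`. -/
def eps (φ : ℤ → k) : U k →ₗ[k] k :=
  MvPolynomial.lcoeff k 0 ∘ₗ LinearMap.applyₗ (1 : Pol k) ∘ₗ (polRep φ).toLinearMap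

theorem eps_apply (φ : ℤ → k) (u : U k) :
    eps φ u = MvPolynomial.constantCoeff (polRep φ u 1) := rfl

theorem eps_one (φ : ℤ → k) : eps φ 1 = 1 := by
  rw [eps_apply, map_one (polRep φ), Module.End.one_apply]
  exact map_one _

/-- A multiple of a linear form has no constant term. -/
theorem eps_slF_mul (φ : ℤ → k) (u : U k) (a : k[T;T⁻¹]) : eps φ (el (slF k) a * u) = 0 := by
  have h : (MvPolynomial.constantCoeff : Pol k →+* k) (linForm k a) = 0 := by
    have : (MvPolynomial.lcoeff k 0) ∘ₗ linForm k = (0 : k[T;T⁻¹] →ₗ[k] k) :=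
      laurent_hom_ext fun n => by
        rw [LinearMap.comp_apply, linForm_T]
        exact MvPolynomial.constantCoeff_X k n
    exact LinearMap.congr_fun this a
  rw [eps_apply, map_mul, Module.End.mul_apply, polRep_slF, opF_apply, map_mul, h, zero_mul]

end Verma

/-! ## Layers of a highest-weight module -/

section Layers

variable {M : Type*} [AddCommGroup M] [Module k M] (ρ : U k →ₐ[k] Module.End k M)

/-- The operators `f ⊗ a` as a bilinear map. -/
def lower : k[T;T⁻¹] →ₗ[k] M →ₗ[k] M := ρ.toLinearMap ∘ₗ elL (slF k)

theorem lower_apply (a : k[T;T⁻¹]) (w : M) : lower ρ a w = ρ (el (slF k) a) w := rfl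

/-- The span of the `(f ⊗ a₁) ⋯ (f ⊗ aₙ) w` with `w ∈ N`. -/
def layer (N : Submodule k M) : ℕ → Submodule k M
  | 0 => N
  | n + 1 => Submodule.map₂ (lower ρ) ⊤ (layer N n)

variable {ρ}

theorem lower_mem_layer {N : Submodule k M} {n : ℕ} (a : k[T;T⁻¹]) {w : M}
    (hw : w ∈ layer ρ N n) : ρ (el (slF k) a) w ∈ layer ρ N (n + 1) :=
  Submodule.apply_mem_map₂ (lower ρ) (Submodule.mem_top (x := a)) hw

theorem rep_el_rep_el (x y : Sl2 k) (a b : k[T;T⁻¹]) (w : M) :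
    ρ (el x a) (ρ (el y b) w) = ρ (el y b) (ρ (el x a) w) + ρ (el ⁅x, y⁆ (a * b)) w := by
  rw [← Module.End.mul_apply, ← map_mul, el_mul, map_add, map_mul, LinearMap.add_apply,
    Module.End.mul_apply]

theorem rep_slH_slF (a b : k[T;T⁻¹]) (w : M) : ρ (el (slH k) a) (ρ (el (slF k) b) w) =
    ρ (el (slF k) b) (ρ (el (slH k) a) w) - (2 : k) • ρ (el (slF k) (a * b)) w := by
  rw [rep_el_rep_el, lie_slH_slF, el_smul_left, map_smul, LinearMap.smul_apply, neg_smul,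
    sub_eq_add_neg]

theorem rep_slE_slF (a b : k[T;T⁻¹]) (w : M) : ρ (el (slE k) a) (ρ (el (slF k) b) w) =
    ρ (el (slF k) b) (ρ (el (slE k) a) w) + ρ (el (slH k) (a * b)) w := by
  rw [rep_el_rep_el, lie_slE_slF]

theorem slH_mem_layer {N : Submodule k M} (hH : ∀ a, ∀ w ∈ N, ρ (el (slH k) a) w ∈ N) (n : ℕ)
    (a : k[T;T⁻¹]) : layer ρ N n ≤ (layer ρ N n).comap (ρ (el (slH k) a)) := by
  induction n generalizing a with
  | zero => exact fun w hw => hH a w hw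
  | succ n ih =>
    refine Submodule.map₂_le.2 fun b _ w hw => ?_
    rw [Submodule.mem_comap, lower_apply, rep_slH_slF]
    exact Submodule.sub_mem _ (lower_mem_layer b (ih a hw))
      (Submodule.smul_mem _ _ (lower_mem_layer _ hw))

/-- Moving `e` past the leftmost `f` costs an `h`, which preserves the layer below. -/
theorem slE_mem_layer {N : Submodule k M} (hE : ∀ a, ∀ w ∈ N, ρ (el (slE k) a) w = 0)
    (hH : ∀ a, ∀ w ∈ N, ρ (el (slH k) a) w ∈ N) (n : ℕ)
    (a : k[T;T⁻¹]) : layer ρ N (n + 1) ≤ (layer ρ N n).comap (ρ (el (slE k) a)) := by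
  induction n generalizing a with
  | zero =>
    refine Submodule.map₂_le.2 fun b _ w hw => ?_
    rw [Submodule.mem_comap, lower_apply, rep_slE_slF, hE a w hw, map_zero, zero_add]
    exact hH _ w hw
  | succ n ih =>
    refine Submodule.map₂_le.2 fun b _ w hw => ?_
    rw [Submodule.mem_comap, lower_apply, rep_slE_slF]
    exact Submodule.add_mem _ (lower_mem_layer b (ih a hw)) (slH_mem_layer hH _ _ hw)

/-- The sum of the layers is stable under the enveloping algebra. -/
theorem rep_mem_iSup_layer {N : Submodule k M} (hE : ∀ a, ∀ w ∈ N, ρ (el (slE k) a) w = 0)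
    (hH : ∀ a, ∀ w ∈ N, ρ (el (slH k) a) w ∈ N) (u : U k) :
    ∀ w ∈ ⨆ n, layer ρ N n, ρ u w ∈ ⨆ n, layer ρ N n := by
  induction u using u_induction with
  | hel x a =>
    have hle : ∀ n, layer ρ N n ≤ (⨆ n, layer ρ N n).comap (ρ (el x a)) := by
      intro n w hw
      rw [Submodule.mem_comap, el_decomp, map_add, map_add, map_smul, map_smul, map_smul]
      refine Submodule.add_mem _ (Submodule.add_mem _ (Submodule.smul_mem _ _ ?_)
        (Submodule.smul_mem _ _ ?_)) (Submodule.smul_mem _ _ ?_)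
      · cases n with
        | zero => rw [hE a w hw]; exact Submodule.zero_mem _
        | succ n => exact Submodule.mem_iSup_of_mem n (slE_mem_layer hE hH n a hw)
      · exact Submodule.mem_iSup_of_mem n (slH_mem_layer hH n a hw)
      · exact Submodule.mem_iSup_of_mem (n + 1) (lower_mem_layer a hw)
    exact fun w hw => iSup_le hle hw
  | hc c =>
    intro w hw
    rw [AlgHom.commutes]
    exact Submodule.smul_mem _ c hw
  | hadd u v hu hv =>
    intro w hw
    rw [map_add]
    exact Submodule.add_mem _ (hu w hw) (hv w hw)
  | hmul u v hu hv =>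
    intro w hw
    rw [map_mul]
    exact hu _ (hv w hw)

theorem layer_le_eigenspace {N : Submodule k M} {c : k}
    (hN : ∀ w ∈ N, ρ (el (slH k) 1) w = c • w) (n : ℕ) :
    layer ρ N n ≤ (ρ (el (slH k) 1)).eigenspace (c - 2 * n) := by
  induction n with
  | zero =>
    intro w hw
    rw [Module.End.mem_eigenspace_iff, hN w hw]
    simp
  | succ n ih =>
    refine Submodule.map₂_le.2 fun b _ w hw => ?_
    have h1 := Module.End.mem_eigenspace_iff.1 (ih hw)
    rw [Module.End.mem_eigenspace_iff, lower_apply, rep_slH_slF, h1, one_mul, map_smul, ← sub_smul]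
    congr 1
    push_cast
    ring

/-- The vector `v` generates the module and has highest weight `φ`. -/
structure IsHighestWeight (ρ : U k →ₐ[k] Module.End k M) (φ : ℤ → k) (v : M) : Prop where
  annihilated : ∀ a, ρ (el (slE k) a) v = 0
  weight : ∀ a, ρ (el (slH k) a) v = ev φ a • v
  gen : ∀ w, ∃ u, ρ u v = w

variable {φ : ℤ → k} {v : M}

/-- The sum of the layers is a submodule containing the generator. Thus monomials in the `f ⊗ a`
alone, applied to `v`, span the module. -/
theorem IsHighestWeight.iSup_layer (h : IsHighestWeight ρ φ v) :
    ⨆ n, layer ρ (k ∙ v) n = ⊤ := by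
  refine eq_top_iff.2 fun w _ => ?_
  obtain ⟨u, rfl⟩ := h.gen w
  refine rep_mem_iSup_layer ?_ ?_ u v (Submodule.mem_iSup_of_mem 0 ?_)
  · intro a w hw
    obtain ⟨c, rfl⟩ := Submodule.mem_span_singleton.1 hw
    rw [map_smul, h.annihilated, smul_zero]
  · intro a w hw
    obtain ⟨c, rfl⟩ := Submodule.mem_span_singleton.1 hw
    rw [map_smul, h.weight]
    exact Submodule.smul_mem _ _ (Submodule.smul_mem _ _ (Submodule.mem_span_singleton_self v))
  · exact Submodule.mem_span_singleton_self v

theorem IsHighestWeight.layer_le (h : IsHighestWeight ρ φ v) (n : ℕ) :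
    layer ρ (k ∙ v) n ≤ (ρ (el (slH k) 1)).eigenspace (φ 0 - 2 * n) := by
  refine layer_le_eigenspace (fun w hw => ?_) n
  obtain ⟨c, rfl⟩ := Submodule.mem_span_singleton.1 hw
  rw [map_smul, h.weight, ev_one, smul_comm]

end Layers

/-! ### Eigenspaces of `h ⊗ 1` and polynomials in it. -/

section Eigen

variable {M : Type*} [AddCommGroup M] [Module k M]

/-- Eigenspaces for distinct eigenvalues are independent, so subspaces of them that already span
leave no room for anything more. -/
theorem eigenspace_eq_of_le {ι : Type*} {A : Module.End k M} {μ : ι → k}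
    (hμ : Function.Injective μ) {G : ι → Submodule k M} (hG : ∀ n, G n ≤ A.eigenspace (μ n))
    (htop : ⨆ n, G n = ⊤) (n : ι) : A.eigenspace (μ n) = G n := by
  refine le_antisymm (fun x hx => ?_) (hG n)
  have h1 : x ∈ G n ⊔ ⨆ (m) (_ : m ≠ n), G m := by
    rw [← iSup_split_single G n, htop]
    exact Submodule.mem_top
  obtain ⟨y, hy, z, hz, rfl⟩ := Submodule.mem_sup.1 h1
  have hz' : z ∈ A.eigenspace (μ n) := by
    have := Submodule.sub_mem _ hx (hG n hy)
    rwa [add_sub_cancel_left] at this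
  have hind := (A.eigenspaces_iSupIndep.comp hμ) n
  have hz0 : z = 0 := by
    refine (Submodule.disjoint_def.1 hind) z hz' ?_
    exact iSup₂_mono (fun m _ => hG m) hz
  rw [hz0, add_zero]
  exact hy

theorem isInternal_eigenspace {A : Module.End k M} {μ : ℕ → k}
    (hμ : Function.Injective μ) {G : ℕ → Submodule k M} (hG : ∀ n, G n ≤ A.eigenspace (μ n))
    (htop : ⨆ n, G n = ⊤) : DirectSum.IsInternal fun n => A.eigenspace (μ n) := by
  refine DirectSum.isInternal_submodule_of_iSupIndep_of_iSup_eq_top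
    (A.eigenspaces_iSupIndep.comp hμ) (eq_top_iff.2 ?_)
  rw [← htop]
  exact iSup_mono hG

theorem weight_injective [CharZero k] (c : k) :
    Function.Injective fun n : ℕ => c - 2 * (n : k) := by
  intro m n h
  have h1 : (2 : k) * m = 2 * n := sub_right_injective h
  exact_mod_cast mul_left_cancel₀ two_ne_zero h1

theorem smul_eq_of_eigen {A : Type*} [Ring A] [Algebra k A] [Module A M] [IsScalarTower k A M]
    {h : A} {v : M} {c : k} (hv : h • v = c • v) (p : k[X]) :
    (aeval h p) • v = (p.eval c) • v := by
  obtain ⟨q, hq⟩ := Polynomial.X_sub_C_dvd_sub_C_eval (a := c) (p := p)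
  rw [sub_eq_iff_eq_add, mul_comm] at hq
  conv_lhs => rw [hq]
  rw [map_add, map_mul, add_smul, mul_smul, map_sub, aeval_X, aeval_C, aeval_C, sub_smul, hv,
    algebraMap_smul, sub_self, smul_zero, zero_add, algebraMap_smul]

end Eigen

/-! ## The induced module and its irreducible quotient -/

section Quotients

variable (φ : ℤ → k)

/-- The action of the enveloping algebra on the induced module. -/
def indRep : U k →ₐ[k] Module.End k (Ind φ) := Algebra.lsmul k k (Ind φ)

/-- The action of the enveloping algebra on `L(φ)`. -/
def lRep : U k →ₐ[k] Module.End k (L φ) := Algebra.lsmul k k (L φ)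

theorem indRep_apply (u : U k) (w : Ind φ) : indRep φ u w = u • w := rfl

theorem lRep_apply (u : U k) (w : L φ) : lRep φ u w = u • w := rfl

theorem smul_mk_one (u : U k) :
    u • (Submodule.Quotient.mk 1 : Ind φ) = Submodule.Quotient.mk u := by
  rw [← Submodule.Quotient.mk_smul, smul_eq_mul, mul_one]

theorem smul_vac (u : U k) : u • vac φ = Submodule.Quotient.mk (Submodule.Quotient.mk u) := by
  rw [← smul_mk_one φ u]
  rfl

theorem isHighestWeight_ind : IsHighestWeight (indRep φ) φ (Submodule.Quotient.mk 1) where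
  annihilated a := by
    rw [indRep_apply, smul_mk_one, Submodule.Quotient.mk_eq_zero]
    exact Submodule.subset_span (Or.inl ⟨a, rfl⟩)
  weight a := by
    rw [indRep_apply, ← algebraMap_smul (U k) (ev φ a), smul_mk_one, smul_mk_one,
      Submodule.Quotient.eq]
    exact Submodule.subset_span (Or.inr ⟨a, rfl⟩)
  gen w := by
    obtain ⟨u, rfl⟩ := Submodule.Quotient.mk_surjective _ w
    exact ⟨u, smul_mk_one φ u⟩

theorem isHighestWeight_l : IsHighestWeight (lRep φ) φ (vac φ) where
  annihilated a := by
    have := (isHighestWeight_ind φ).annihilated a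
    rw [indRep_apply] at this
    rw [lRep_apply, vac, ← map_smul]
    exact (congrArg (maxSub φ).mkQ this).trans (map_zero _)
  weight a := by
    have := (isHighestWeight_ind φ).weight a
    rw [indRep_apply] at this
    rw [lRep_apply, vac, ← map_smul]
    exact (congrArg (maxSub φ).mkQ this)
  gen w := by
    obtain ⟨u, rfl⟩ := exists_smul_vac φ w
    exact ⟨u, rfl⟩

variable {φ}

/-- The map `u ↦ u v` kills the defining left ideal of the induced module. -/
theorem rep_eq_zero_of_mem_indIdeal {M : Type*} [AddCommGroup M] [Module k M]
    {ρ : U k →ₐ[k] Module.End k M} {v : M} (hE : ∀ a, ρ (el (slE k) a) v = 0)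
    (hH : ∀ a, ρ (el (slH k) a) v = ev φ a • v) {u : U k} (hu : u ∈ indIdeal φ) : ρ u v = 0 := by
  refine Submodule.span_induction ?_ ?_ ?_ ?_ hu
  · rintro _ (⟨a, rfl⟩ | ⟨a, rfl⟩)
    · exact hE a
    · rw [map_sub, LinearMap.sub_apply, hH, AlgHom.commutes]
      exact sub_self _
  · rw [map_zero, LinearMap.zero_apply]
  · intro x y _ _ hx hy
    rw [map_add, LinearMap.add_apply, hx, hy, add_zero]
  · intro x y _ hy
    rw [smul_eq_mul, map_mul, Module.End.mul_apply, hy, map_zero]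

/-- A functional on the enveloping algebra that vanishes on the left ideal of the induced module
and on the right ideal generated by the `f ⊗ a` is determined by its value at `1`. -/
theorem functional_ext {g g' : U k →ₗ[k] k} (h1 : g 1 = g' 1)
    (hI : ∀ u ∈ indIdeal φ, g u = 0) (hI' : ∀ u ∈ indIdeal φ, g' u = 0)
    (hf : ∀ a u, g (el (slF k) a * u) = 0) (hf' : ∀ a u, g' (el (slF k) a * u) = 0) : g = g' := by
  rw [← sub_eq_zero]
  set d := g - g' with hd
  have hdI : ∀ u ∈ indIdeal φ, d u = 0 := fun u hu => by
    rw [hd, LinearMap.sub_apply, hI u hu, hI' u hu, sub_zero]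
  have hdf : ∀ a u, d (el (slF k) a * u) = 0 := fun a u => by
    rw [hd, LinearMap.sub_apply, hf, hf', sub_zero]
  have hd1 : d 1 = 0 := by rw [hd, LinearMap.sub_apply, h1, sub_self]
  let mk : U k →ₗ[k] Ind φ := (indIdeal φ).mkQ.restrictScalars k
  have hker : LinearMap.ker mk ≤ LinearMap.ker d := by
    intro u hu
    exact hdI u ((Submodule.Quotient.mk_eq_zero _).1 hu)
  -- The layers are spanned by the classes of `1` and of the `(f ⊗ a) u`, all of which `d` kills.
  have hle : ∀ n, layer (indRep φ) (k ∙ Submodule.Quotient.mk 1) n ≤ (LinearMap.ker d).map mk := by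
    intro n
    cases n with
    | zero =>
      refine (Submodule.span_singleton_le_iff_mem _ _).2 ⟨1, hd1, rfl⟩
    | succ n =>
      refine Submodule.map₂_le.2 fun a _ w _ => ?_
      obtain ⟨u, rfl⟩ := Submodule.Quotient.mk_surjective _ w
      exact ⟨el (slF k) a * u, hdf a u, rfl⟩
  refine LinearMap.ext fun u => ?_
  have hu : mk u ∈ (LinearMap.ker d).map mk := by
    have := iSup_le hle
    rw [(isHighestWeight_ind φ).iSup_layer] at this
    exact this Submodule.mem_top
  obtain ⟨u', hu', huu⟩ := hu
  -- The two representatives differ by an element of the left ideal, where `d` vanishes as well.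
  have h2 : u - u' ∈ LinearMap.ker d := hker (by rw [LinearMap.mem_ker, map_sub, huu, sub_self])
  have h3 := Submodule.add_mem _ h2 hu'
  rwa [sub_add_cancel] at h3

variable (φ)

/-- In the polynomial realisation `1` has highest weight `φ`, so the left ideal annihilates it. -/
theorem eps_eq_zero_of_mem_indIdeal (x : U k) {u : U k} (hu : u ∈ indIdeal φ) :
    eps φ (x * u) = 0 := by
  have := rep_eq_zero_of_mem_indIdeal (φ := φ) (ρ := polRep φ) (v := 1)
    (fun a => by rw [polRep_slE, opE_one]) (fun a => by rw [polRep_slH, opH_one]) hu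
  rw [eps_apply, map_mul, Module.End.mul_apply, this, map_zero, map_zero]

/-- The left ideal of those `u` for which `u v` has no component along `v` even after applying
the enveloping algebra. -/
def epsKer : Submodule (U k) (U k) where
  carrier := {u | ∀ x, eps φ (x * u) = 0}
  zero_mem' x := by rw [mul_zero, map_zero]
  add_mem' {u v} hu hv x := by rw [mul_add, map_add, hu x, hv x, add_zero]
  smul_mem' c {u} hu x := by rw [smul_eq_mul, ← mul_assoc]; exact hu _

theorem mem_epsKer {u : U k} : u ∈ epsKer φ ↔ ∀ x, eps φ (x * u) = 0 := Iff.rfl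

theorem indIdeal_le_epsKer : indIdeal φ ≤ epsKer φ :=
  fun _ hu x => eps_eq_zero_of_mem_indIdeal φ x hu

/-- Such a class has a representative that is a sum of elements `(f ⊗ a) u`, and `eps` is constant
on classes modulo `indIdeal`. -/
theorem eps_eq_zero_of_mk_mem_layer {n : ℕ} :
    ∀ u, (Submodule.Quotient.mk u : Ind φ) ∈
      layer (indRep φ) (k ∙ Submodule.Quotient.mk 1) (n + 1) → eps φ u = 0 := by
  let mk : U k →ₗ[k] Ind φ := (indIdeal φ).mkQ.restrictScalars k
  have hle : layer (indRep φ) (k ∙ Submodule.Quotient.mk 1) (n + 1) ≤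
      (LinearMap.ker (eps φ)).map mk := by
    refine Submodule.map₂_le.2 fun a _ w _ => ?_
    obtain ⟨u, rfl⟩ := Submodule.Quotient.mk_surjective _ w
    exact ⟨el (slF k) a * u, eps_slF_mul φ u a, rfl⟩
  intro u hu
  obtain ⟨u', hu', huu⟩ := hle hu
  have h2 : u - u' ∈ indIdeal φ := (Submodule.Quotient.eq _).1 huu.symm
  have h3 := eps_eq_zero_of_mem_indIdeal φ 1 h2
  rw [one_mul, map_sub] at h3
  rw [sub_eq_zero.1 h3]
  exact hu'

/-- The map `u ↦ u v` onto `L(φ)`. -/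
def orbit : U k →ₗ[k] L φ := LinearMap.applyₗ (vac φ) ∘ₗ (lRep φ).toLinearMap

theorem orbit_apply (u : U k) : orbit φ u = u • vac φ := rfl

theorem orbit_surjective : Function.Surjective (orbit φ) := fun w => by
  obtain ⟨u, rfl⟩ := exists_smul_vac φ w
  exact ⟨u, rfl⟩

-- `exists_stable` provides stability under the forward shift only. On a finite-dimensional space
-- the injective shift is surjective, so the backward shift preserves the space too.
variable {φ} in
theorem exists_finiteDimensional_act (hφ : φ ∈ expPoly k) :
    ∃ W : Submodule k (ℤ → k), FiniteDimensional k W ∧ ∀ a, act k a φ ∈ W := by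
  obtain ⟨W, hW, hφW, sW⟩ := exists_stable hφ
  refine ⟨W, hW, ?_⟩
  let s : W →ₗ[k] W :=
    { toFun := fun f => ⟨fun m => f.1 (m + 1), sW _ f.2⟩
      map_add' := fun _ _ => rfl
      map_smul' := fun _ _ => rfl }
  have hs : Function.Injective s := by
    intro f g hfg
    refine Subtype.ext (funext fun m => ?_)
    have := congrFun (congrArg Subtype.val hfg) (m - 1)
    simpa [s] using this
  have hsurj : Function.Surjective s := LinearMap.injective_iff_surjective.1 hs
  have hneg : ∀ f ∈ W, (fun m => f (m - 1)) ∈ W := by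
    intro f hf
    obtain ⟨g, hg⟩ := hsurj ⟨f, hf⟩
    have : (fun m => f (m - 1)) = g.1 := by
      funext m
      have := congrFun (congrArg Subtype.val hg) (m - 1)
      simpa [s] using this.symm
    rw [this]
    exact g.2
  have hT : ∀ n : ℤ, act k (T n) φ ∈ W := by
    intro n
    rw [show act k (T n) φ = fun m => φ (m + n) from funext fun m => act_T φ n m]
    induction n using Int.induction_on with
    | zero => simpa using hφW
    | succ n ih =>
      have := sW _ ih
      convert this using 3
      ring
    | pred n ih =>
      have := hneg _ ih
      convert this using 3
      ring
  have hle : W.mkQ ∘ₗ LinearMap.applyₗ φ ∘ₗ (act k).toLinearMap = 0 :=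
    laurent_hom_ext fun n => (Submodule.Quotient.mk_eq_zero _).2 (hT n)
  exact fun a => (Submodule.Quotient.mk_eq_zero _).1 (LinearMap.congr_fun hle a)

variable [CharZero k]

/-- A polynomial in `h ⊗ 1` projects a vector of the induced module to its component along the
highest-weight vector, up to a non-zero scalar. -/
theorem exists_projection (u : U k) : ∃ p : k[X], p.eval (φ 0) ≠ 0 ∧
    (aeval (el (slH k) 1) p) • (Submodule.Quotient.mk u : Ind φ) =
      (p.eval (φ 0) * eps φ u) • (Submodule.Quotient.mk 1 : Ind φ) := by
  have hv : el (slH k) 1 • (Submodule.Quotient.mk 1 : Ind φ) =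
      φ 0 • (Submodule.Quotient.mk 1 : Ind φ) := by
    have := (isHighestWeight_ind φ).weight 1
    rwa [ev_one, indRep_apply] at this
  have hmem : (Submodule.Quotient.mk u : Ind φ) ∈
      ⨆ n, layer (indRep φ) (k ∙ Submodule.Quotient.mk 1) n := by
    rw [(isHighestWeight_ind φ).iSup_layer]
    exact Submodule.mem_top
  -- The representative stays arbitrary: the induction runs over vectors of the quotient, whereas
  -- `eps` lives on the enveloping algebra.
  suffices H : ∀ m ∈ ⨆ n, layer (indRep φ) (k ∙ (Submodule.Quotient.mk 1 : Ind φ)) n,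
      ∀ u, Submodule.Quotient.mk u = m → ∃ p : k[X], p.eval (φ 0) ≠ 0 ∧
      (aeval (el (slH k) 1) p) • m =
        (p.eval (φ 0) * eps φ u) • (Submodule.Quotient.mk 1 : Ind φ) from H _ hmem u rfl
  intro m hm
  induction hm using Submodule.iSup_induction' with
  | zero =>
    intro u hu
    have h0 := eps_eq_zero_of_mem_indIdeal φ 1 ((Submodule.Quotient.mk_eq_zero _).1 hu)
    rw [one_mul] at h0
    exact ⟨1, by simp, by rw [h0, smul_zero, mul_zero, zero_smul]⟩
  | add m m' _ _ hm hm' =>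
    intro w hw
    obtain ⟨u, rfl⟩ := Submodule.Quotient.mk_surjective _ m
    obtain ⟨u', rfl⟩ := Submodule.Quotient.mk_surjective _ m'
    obtain ⟨p, hp, hpu⟩ := hm u rfl
    obtain ⟨p', hp', hpu'⟩ := hm' u' rfl
    have h0 := eps_eq_zero_of_mem_indIdeal φ 1 ((Submodule.Quotient.eq _).1 hw)
    rw [one_mul, map_sub, map_add, sub_eq_zero] at h0
    -- Each factor projects one summand; the other factor then acts on the highest-weight line as
    -- its value at `φ 0`.
    refine ⟨p * p', by rw [eval_mul]; exact mul_ne_zero hp hp', ?_⟩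
    rw [smul_add]
    conv_lhs =>
      congr
      · rw [mul_comm p p', map_mul, mul_smul, hpu, smul_comm, smul_eq_of_eigen hv, smul_smul]
      · rw [map_mul, mul_smul, hpu', smul_comm, smul_eq_of_eigen hv, smul_smul]
    rw [← add_smul, eval_mul, h0]
    congr 1
    ring
  | mem n m hm =>
    intro u hu
    cases n with
    | zero =>
      obtain ⟨c, rfl⟩ := Submodule.mem_span_singleton.1 hm
      refine ⟨1, by simp, ?_⟩
      have h1 : u - algebraMap k (U k) c ∈ indIdeal φ := by
        rw [← Submodule.Quotient.eq, hu, ← algebraMap_smul (U k) c, smul_mk_one]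
      have h0 := eps_eq_zero_of_mem_indIdeal φ 1 h1
      rw [one_mul, map_sub, Algebra.algebraMap_eq_smul_one, map_smul, eps_one, sub_eq_zero] at h0
      rw [h0, map_one, one_smul, eval_one, one_mul, smul_eq_mul, mul_one]
    | succ n =>
      -- This kills layer `n + 1`, and its value at `φ 0` is `2 (n + 1)`, non-zero in characteristic
      -- zero.
      refine ⟨X - Polynomial.C (φ 0 - 2 * ((n + 1 : ℕ) : k)), ?_, ?_⟩
      · rw [eval_sub, eval_X, eval_C, sub_sub_cancel]
        exact mul_ne_zero two_ne_zero (Nat.cast_ne_zero.2 n.succ_ne_zero)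
      · have h1 := Module.End.mem_eigenspace_iff.1 ((isHighestWeight_ind φ).layer_le (n + 1) hm)
        rw [indRep_apply] at h1
        rw [eps_eq_zero_of_mk_mem_layer φ u (hu ▸ hm), smul_eq_of_eigen h1, eval_sub, eval_X,
          eval_C, sub_self, zero_smul, mul_zero, zero_smul]

/-- A submodule with a vector of non-zero `v`-component contains `v` by `exists_projection`, hence
everything. Conversely `epsKer` gives a proper submodule because `eps φ 1 = 1`. -/
theorem maxSub_eq : maxSub φ = (epsKer φ).map (indIdeal φ).mkQ := by
  refine le_antisymm (sSup_le fun N hN => ?_) (le_sSup ?_)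
  · intro m hm
    obtain ⟨u, rfl⟩ := Submodule.Quotient.mk_surjective _ m
    refine ⟨u, fun x => ?_, rfl⟩
    by_contra h
    obtain ⟨p, hp, hpu⟩ := exists_projection φ (x * u)
    have h1 : (p.eval (φ 0) * eps φ (x * u)) • (Submodule.Quotient.mk 1 : Ind φ) ∈ N := by
      rw [← hpu]
      exact N.smul_mem _ (N.smul_mem x hm)
    have h2 : (Submodule.Quotient.mk 1 : Ind φ) ∈ N := by
      have h3 := (N.restrictScalars k).smul_mem (p.eval (φ 0) * eps φ (x * u))⁻¹ h1
      rwa [smul_smul, inv_mul_cancel₀ (mul_ne_zero hp h), one_smul] at h3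
    refine hN (eq_top_iff.2 fun w _ => ?_)
    obtain ⟨y, rfl⟩ := Submodule.Quotient.mk_surjective _ w
    rw [← smul_mk_one]
    exact N.smul_mem y h2
  · intro htop
    have h1 : (Submodule.Quotient.mk 1 : Ind φ) ∈ (epsKer φ).map (indIdeal φ).mkQ :=
      htop ▸ Submodule.mem_top
    obtain ⟨u, hu, huu⟩ := h1
    have h2 : u - 1 ∈ epsKer φ := indIdeal_le_epsKer φ ((Submodule.Quotient.eq _).1 huu)
    have h3 : (1 : U k) ∈ epsKer φ := by
      have := Submodule.sub_mem _ hu h2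
      rwa [sub_sub_cancel] at this
    have h4 := h3 1
    rw [mul_one, eps_one] at h4
    exact one_ne_zero h4

/-- The annihilator of the highest-weight vector depends on `eps` alone, so `L(φ)` can be compared
with other modules by comparing functionals. -/
theorem smul_vac_eq_zero_iff {u : U k} : u • vac φ = 0 ↔ ∀ x, eps φ (x * u) = 0 := by
  rw [smul_vac, Submodule.Quotient.mk_eq_zero, maxSub_eq, ← mem_epsKer]
  constructor
  · rintro ⟨u', hu', huu⟩
    have h2 : u' - u ∈ epsKer φ := indIdeal_le_epsKer φ ((Submodule.Quotient.eq _).1 huu)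
    have := Submodule.sub_mem _ hu' h2
    rwa [sub_sub_cancel] at this
  · intro h
    exact ⟨u, h, rfl⟩

/-- The coefficient of the highest-weight vector, as a functional on `L(φ)`. -/
def epsL : L φ →ₗ[k] k :=
  (LinearMap.ker (orbit φ)).liftQ (eps φ) (fun u hu => by
    have := (smul_vac_eq_zero_iff φ).1 (show u • vac φ = 0 from hu) 1
    rwa [one_mul] at this) ∘ₗ
  ((orbit φ).quotKerEquivOfSurjective (orbit_surjective φ)).symm.toLinearMap

theorem epsL_smul_vac (u : U k) : epsL φ (u • vac φ) = eps φ u := by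
  have : ((orbit φ).quotKerEquivOfSurjective (orbit_surjective φ)).symm (u • vac φ) =
      Submodule.Quotient.mk u := by
    rw [LinearEquiv.symm_apply_eq]
    rfl
  rw [epsL, LinearMap.comp_apply, LinearEquiv.coe_coe, this]
  rfl

theorem epsL_vac : epsL φ (vac φ) = 1 := by
  rw [← one_smul (U k) (vac φ), epsL_smul_vac, eps_one]

theorem epsL_slF_smul (a : k[T;T⁻¹]) (w : L φ) : epsL φ (el (slF k) a • w) = 0 := by
  obtain ⟨u, rfl⟩ := exists_smul_vac φ w
  rw [← mul_smul, epsL_smul_vac, eps_slF_mul]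

theorem eq_zero_of_epsL {w : L φ} (h : ∀ u : U k, epsL φ (u • w) = 0) : w = 0 := by
  obtain ⟨u, rfl⟩ := exists_smul_vac φ w
  refine (smul_vac_eq_zero_iff φ).2 fun x => ?_
  rw [← epsL_smul_vac, mul_smul]
  exact h x

variable {φ}

/-- A module generated by a vector of highest weight `φ`, with a functional that makes it
non-degenerate, is isomorphic to `L(φ)`. -/
theorem exists_equiv_of_isHighestWeight {M : Type*} [AddCommGroup M] [Module k M]
    {ρ : U k →ₐ[k] Module.End k M} {v : M} (h : IsHighestWeight ρ φ v) (δ : M →ₗ[k] k)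
    (hv : δ v = 1) (hf : ∀ a w, δ (ρ (el (slF k) a) w) = 0)
    (hnd : ∀ w, (∀ u, δ (ρ u w) = 0) → w = 0) :
    ∃ Ω : L φ ≃ₗ[k] M, ∀ u : U k, Ω (u • vac φ) = ρ u v := by
  let B : U k →ₗ[k] M := LinearMap.applyₗ v ∘ₗ ρ.toLinearMap
  have hB : Function.Surjective B := h.gen
  have heps : δ ∘ₗ B = eps φ := by
    -- Pulled back along `u ↦ u v`, `δ` has the properties that single out `eps`.
    refine functional_ext (φ := φ) ?_ ?_ ?_ ?_ ?_
    · change δ (ρ 1 v) = _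
      rw [map_one, Module.End.one_apply, hv, eps_one]
    · intro u hu
      change δ (ρ u v) = 0
      rw [rep_eq_zero_of_mem_indIdeal h.annihilated h.weight hu, map_zero]
    · intro u hu
      rw [← one_mul u]
      exact eps_eq_zero_of_mem_indIdeal φ 1 hu
    · intro a u
      change δ (ρ (el (slF k) a * u) v) = 0
      rw [map_mul]
      exact hf a _
    · exact fun a u => eps_slF_mul φ u a
  have heps' : ∀ u, δ (ρ u v) = eps φ u := fun u => LinearMap.congr_fun heps u
  -- Both annihilators consist of the `u` with `eps (x * u) = 0` for all `x`: on one side by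
  -- `smul_vac_eq_zero_iff`, on the other by non-degeneracy of `δ`.
  have hker : LinearMap.ker (orbit φ) = LinearMap.ker B := by
    ext u
    rw [LinearMap.mem_ker, LinearMap.mem_ker, orbit_apply, smul_vac_eq_zero_iff]
    change _ ↔ ρ u v = 0
    constructor
    · intro hu
      refine hnd _ fun x => ?_
      rw [← Module.End.mul_apply, ← map_mul, heps', hu]
    · intro hu x
      rw [← heps', map_mul, Module.End.mul_apply, hu, map_zero, map_zero]
  refine ⟨((orbit φ).quotKerEquivOfSurjective (orbit_surjective φ)).symm ≪≫ₗ
    Submodule.quotEquivOfEq _ _ hker ≪≫ₗ B.quotKerEquivOfSurjective hB, fun u => ?_⟩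
  have : ((orbit φ).quotKerEquivOfSurjective (orbit_surjective φ)).symm (u • vac φ) =
      Submodule.Quotient.mk u := by
    rw [LinearEquiv.symm_apply_eq]
    rfl
  rw [LinearEquiv.trans_apply, LinearEquiv.trans_apply, this]
  rfl

/-- If `b` annihilates `φ`, then `x ⊗ b` annihilates `L(φ)`. -/
theorem el_smul_eq_zero {b : k[T;T⁻¹]} (hb : act k b φ = 0) (x : Sl2 k) (w : L φ) :
    el x b • w = 0 := by
  let A : k[T;T⁻¹] →ₗ[k] (ℤ → k) := LinearMap.applyₗ φ ∘ₗ (act k).toLinearMap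
  have hA : ∀ a c, A c = 0 → A (a * c) = 0 := by
    intro a c hc
    change act k (a * c) φ = 0
    rw [map_mul, Module.End.mul_apply]
    exact (congrArg (act k a) hc).trans (map_zero _)
  have hev : ∀ a c, A c = 0 → ev φ (a * c) = 0 := fun a c hc => ev_mul_of_act_eq_zero hc a
  -- The vectors `(f ⊗ c) v` with `c` annihilating `φ`. They are singular: `e ⊗ a` sends them to `ev
  -- φ (a * c) • v = 0`, and the `h ⊗ a` preserve their span.
  let N : Submodule k (L φ) :=
    (LinearMap.ker A).map (orbit φ ∘ₗ elL (slF k))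
  have hF : ∀ c, A c = 0 → el (slF k) c • vac φ = 0 := by
    intro c hc
    refine eq_zero_of_epsL φ fun u => ?_
    have hmem : lRep φ u (el (slF k) c • vac φ) ∈ ⨆ n, layer (lRep φ) N n := by
      refine rep_mem_iSup_layer ?_ ?_ u _ (Submodule.mem_iSup_of_mem 0 ⟨c, hc, rfl⟩)
      · rintro a _ ⟨d, hd, rfl⟩
        change lRep φ (el (slE k) a) (lRep φ (el (slF k) d) (vac φ)) = 0
        rw [rep_slE_slF, (isHighestWeight_l φ).annihilated, map_zero, zero_add,
          (isHighestWeight_l φ).weight, hev a d hd, zero_smul]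
      · rintro a _ ⟨d, hd, rfl⟩
        change lRep φ (el (slH k) a) (lRep φ (el (slF k) d) (vac φ)) ∈ N
        rw [rep_slH_slF, (isHighestWeight_l φ).weight, map_smul]
        exact Submodule.sub_mem _ (Submodule.smul_mem _ _ ⟨d, hd, rfl⟩)
          (Submodule.smul_mem _ _ ⟨a * d, hA a d hd, rfl⟩)
    -- Even layer `0` lies in the image of the `f ⊗ d`, so the submodule generated by `N` never
    -- reaches `v`.
    have hle : ∀ n, layer (lRep φ) N n ≤ LinearMap.ker (epsL φ) := by
      intro n
      cases n with
      | zero =>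
        rintro _ ⟨d, _, rfl⟩
        exact epsL_slF_smul φ d (vac φ)
      | succ n => exact Submodule.map₂_le.2 fun a _ w _ => epsL_slF_smul φ a w
    exact iSup_le hle hmem
  have hvac : ∀ c, A c = 0 → ∀ x : Sl2 k, el x c • vac φ = 0 := by
    intro c hc x
    have h1 := (isHighestWeight_l φ).annihilated c
    have h2 := (isHighestWeight_l φ).weight c
    rw [lRep_apply] at h1 h2
    have h3 := hev 1 c hc
    rw [one_mul] at h3
    rw [el_decomp, add_smul, add_smul, smul_assoc, smul_assoc, smul_assoc, hF c hc, h1, h2, h3]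
    simp
  obtain ⟨u, rfl⟩ := exists_smul_vac φ w
  -- Being killed by all `x ⊗ c` passes from `w` to `u • w`, since the `c` form an ideal and
  -- commutators stay of the same kind.
  have key : ∀ w : L φ, (∀ c, A c = 0 → ∀ x : Sl2 k, el x c • w = 0) →
      ∀ c, A c = 0 → ∀ x : Sl2 k, el x c • u • w = 0 := by
    induction u using u_induction with
    | hel y a =>
      intro w hw c hc x
      rw [← mul_smul, el_mul, add_smul, mul_smul, hw c hc, smul_zero, zero_add, mul_comm c a]
      exact hw _ (hA a c hc) _
    | hc d =>
      intro w hw c hc x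
      rw [algebraMap_smul, smul_comm, hw c hc, smul_zero]
    | hadd u v hu hv =>
      intro w hw c hc x
      rw [add_smul, smul_add, hu w hw c hc, hv w hw c hc, add_zero]
    | hmul u v hu hv =>
      intro w hw c hc x
      rw [mul_smul]
      exact hu _ (hv w hw) c hc x
  exact key _ hvac b hb x

/-! ### Finite-dimensionality -/

/-- The action of `f ⊗ a` depends only on `a` modulo the annihilator of `φ`, and this quotient
embeds into the finite-dimensional space of `exists_finiteDimensional_act`. -/
theorem finiteDimensional_range_lower (hφ : φ ∈ expPoly k) :
    FiniteDimensional k (LinearMap.range (lower (lRep φ))) := by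
  obtain ⟨W, hW, hWφ⟩ := exists_finiteDimensional_act hφ
  let A : k[T;T⁻¹] →ₗ[k] W := (LinearMap.applyₗ φ ∘ₗ (act k).toLinearMap).codRestrict W hWφ
  have hker : LinearMap.ker A ≤ LinearMap.ker (lower (lRep φ)) := by
    intro b hb
    have h1 : act k b φ = 0 := congrArg Subtype.val hb
    exact LinearMap.ext fun w => el_smul_eq_zero h1 _ w
  have h2 : FiniteDimensional k (k[T;T⁻¹] ⧸ LinearMap.ker A) :=
    Module.Finite.equiv A.quotKerEquivRange.symm
  have h3 : LinearMap.range (lower (lRep φ)) =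
      LinearMap.range ((LinearMap.ker A).liftQ (lower (lRep φ)) hker) :=
    (Submodule.range_liftQ _ _ _).symm
  rw [h3]
  infer_instance

theorem finiteDimensional_layer (hφ : φ ∈ expPoly k) (n : ℕ) :
    FiniteDimensional k (layer (lRep φ) (k ∙ vac φ) n) := by
  induction n with
  | zero =>
    change FiniteDimensional k (k ∙ vac φ)
    infer_instance
  | succ n ih =>
    have h1 : layer (lRep φ) (k ∙ vac φ) (n + 1) ≤ Submodule.map₂ LinearMap.id
        (LinearMap.range (lower (lRep φ))) (layer (lRep φ) (k ∙ vac φ) n) :=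
      Submodule.map₂_le.2 fun a _ w hw =>
        Submodule.apply_mem_map₂ LinearMap.id (LinearMap.mem_range_self _ a) hw
    have h2 := finiteDimensional_range_lower hφ
    have h3 : FiniteDimensional k (Submodule.map₂ (LinearMap.id : (L φ →ₗ[k] L φ) →ₗ[k] _)
        (LinearMap.range (lower (lRep φ))) (layer (lRep φ) (k ∙ vac φ) n)) :=
      Module.Finite.iff_fg.2
        (Submodule.FG.map₂ _ (Module.Finite.iff_fg.1 h2) (Module.Finite.iff_fg.1 ih))
    exact Submodule.finiteDimensional_of_le h1

theorem gr_eq_layer (n : ℕ) : gr φ n = layer (lRep φ) (k ∙ vac φ) n :=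
  eigenspace_eq_of_le (weight_injective (φ 0)) (isHighestWeight_l φ).layer_le
    (isHighestWeight_l φ).iSup_layer n

theorem isNatGrading_gr (hφ : φ ∈ expPoly k) : IsNatGrading (gr φ) :=
  ⟨isInternal_eigenspace (weight_injective (φ 0)) (isHighestWeight_l φ).layer_le
    (isHighestWeight_l φ).iSup_layer, fun n => by
      rw [gr_eq_layer]
      exact finiteDimensional_layer hφ n⟩

end Quotients

/-! ## Tensor powers -/

section TensorPower

variable {V : Type*} [AddCommGroup V] [Module k V] {r : ℕ}

/-- The endomorphism that acts by `g` on the `i`-th tensor factor. -/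
def atPos (i : Fin r) : Module.End k V →ₐ[k] Module.End k (TPow k V r) :=
  AlgHom.ofLinearMap
    ((PiTensorProduct.mapMultilinear k (fun _ : Fin r => V) (fun _ => V)).toLinearMap
      (fun _ => LinearMap.id) i)
    (by
      rw [MultilinearMap.toLinearMap_apply]
      have : Function.update (fun _ : Fin r => (LinearMap.id : V →ₗ[k] V)) i 1 = fun _ => 1 :=
        Function.update_eq_self i _
      rw [this]
      exact PiTensorProduct.map_one)
    (fun f g => by
      simp only [MultilinearMap.toLinearMap_apply]
      refine Eq.trans ?_ (PiTensorProduct.map_mul _ _)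
      refine congrArg PiTensorProduct.map (funext fun j => ?_)
      by_cases hj : j = i
      · subst hj
        simp only [Function.update_self]
      · simp only [Function.update_of_ne hj]
        rfl)

theorem atPos_tprod (i : Fin r) (g : Module.End k V) (v : Fin r → V) :
    atPos i g (PiTensorProduct.tprod k v) =
      PiTensorProduct.tprod k (Function.update v i (g (v i))) := by
  have h : atPos i g = PiTensorProduct.map
      (Function.update (fun _ : Fin r => (LinearMap.id : V →ₗ[k] V)) i g) := rfl
  rw [h, PiTensorProduct.map_tprod]
  refine congrArg _ (funext fun j => ?_)
  by_cases hj : j = i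
  · subst hj
    simp only [Function.update_self]
  · simp only [Function.update_of_ne hj]
    rfl

theorem atPos_commute {i j : Fin r} (hij : i ≠ j) (f g : Module.End k V) :
    atPos i f * atPos j g = atPos j g * atPos i f := by
  refine PiTensorProduct.ext (MultilinearMap.ext fun v => ?_)
  simp only [LinearMap.compMultilinearMap_apply, Module.End.mul_apply, atPos_tprod,
    Function.update_of_ne hij, Function.update_of_ne hij.symm]
  rw [Function.update_comm hij]

/-- A tensor product of endomorphisms is the product of its single-factor actions, built up one
position at a time. -/
theorem map_mem_of_atPos_mem {S : Subalgebra k (Module.End k (TPow k V r))}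
    {f : Fin r → Module.End k V} (h : ∀ i, atPos i (f i) ∈ S) : PiTensorProduct.map f ∈ S := by
  have key : ∀ s : Finset (Fin r),
      PiTensorProduct.map (fun i => if i ∈ s then f i else 1) ∈ S := by
    intro s
    induction s using Finset.induction_on with
    | empty =>
      have : (PiTensorProduct.map (fun _ : Fin r => (1 : Module.End k V))) = 1 :=
        PiTensorProduct.map_one
      simp only [Finset.notMem_empty, if_false]
      exact this ▸ S.one_mem
    | insert i s hi ih =>
      have : PiTensorProduct.map (fun j => if j ∈ insert i s then f j else 1) =
          atPos i (f i) * PiTensorProduct.map (fun j => if j ∈ s then f j else 1) := by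
        refine PiTensorProduct.ext (MultilinearMap.ext fun v => ?_)
        simp only [LinearMap.compMultilinearMap_apply, Module.End.mul_apply,
          PiTensorProduct.map_tprod, atPos_tprod]
        refine congrArg _ (funext fun j => ?_)
        by_cases hj : j = i
        · subst hj
          simp [hi]
        · simp [hj]
      rw [this]
      exact S.mul_mem (h i) ih
  have := key Finset.univ
  simpa only [Finset.mem_univ, if_true] using this

/-- The tensor product of functionals. -/
def dualProd (d : Fin r → V →ₗ[k] k) : TPow k V r →ₗ[k] k :=
  PiTensorProduct.lift ((MultilinearMap.mkPiAlgebra k (Fin r) k).compLinearMap d)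

theorem dualProd_tprod (d : Fin r → V →ₗ[k] k) (v : Fin r → V) :
    dualProd d (PiTensorProduct.tprod k v) = ∏ i, d i (v i) := by
  rw [dualProd, PiTensorProduct.lift.tprod]
  rfl

theorem dualProd_map (d : Fin r → V →ₗ[k] k) (f : Fin r → Module.End k V) (w : TPow k V r) :
    dualProd d (PiTensorProduct.map f w) = dualProd (fun i => d i ∘ₗ f i) w := by
  refine LinearMap.congr_fun (f := dualProd d ∘ₗ PiTensorProduct.map f)
    (PiTensorProduct.ext (MultilinearMap.ext fun v => ?_)) w
  simp only [LinearMap.compMultilinearMap_apply, LinearMap.comp_apply, PiTensorProduct.map_tprod,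
    dualProd_tprod]

/-- Every tensor lies in the tensor power of a finite-dimensional subspace. -/
theorem exists_finiteDimensional_mem_range (w : TPow k V r) :
    ∃ W : Submodule k V, FiniteDimensional k W ∧
      w ∈ LinearMap.range (PiTensorProduct.map fun _ : Fin r => W.subtype) := by
  have mono : ∀ {W W' : Submodule k V}, W ≤ W' →
      LinearMap.range (PiTensorProduct.map fun _ : Fin r => W.subtype) ≤
        LinearMap.range (PiTensorProduct.map fun _ : Fin r => W'.subtype) := by
    intro W W' h
    have : (PiTensorProduct.map fun _ : Fin r => W.subtype) =
        (PiTensorProduct.map fun _ : Fin r => W'.subtype) ∘ₗ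
          (PiTensorProduct.map fun _ : Fin r => Submodule.inclusion h) := by
      rw [← PiTensorProduct.map_comp]
      rfl
    rw [this]
    exact LinearMap.range_comp_le_range _ _
  induction w using PiTensorProduct.induction_on with
  | smul_tprod c v =>
    refine ⟨Submodule.span k (Set.range v), FiniteDimensional.span_of_finite k (Set.finite_range v),
      Submodule.smul_mem _ c ⟨PiTensorProduct.tprod k fun i =>
        ⟨v i, Submodule.subset_span ⟨i, rfl⟩⟩, ?_⟩⟩
    rw [PiTensorProduct.map_tprod]
    rfl
  | add x y hx hy =>
    obtain ⟨W, hW, hx⟩ := hx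
    obtain ⟨W', hW', hy⟩ := hy
    exact ⟨W ⊔ W', inferInstance, Submodule.add_mem _ (mono le_sup_left hx)
      (mono le_sup_right hy)⟩

/-- If a space of functionals separates the points of `V`, its tensor products separate the points
of the tensor power. -/
theorem eq_zero_of_dualProd {D : Submodule k (Module.Dual k V)}
    (hD : ∀ v, (∀ d ∈ D, d v = 0) → v = 0) {w : TPow k V r}
    (hw : ∀ d : Fin r → Module.Dual k V, (∀ i, d i ∈ D) → dualProd d w = 0) : w = 0 := by
  obtain ⟨W, hW, w', rfl⟩ := exists_finiteDimensional_mem_range w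
  let R : Submodule k (Module.Dual k W) := D.map (Module.Dual.transpose W.subtype)
  -- On the finite-dimensional `W` a separating space of functionals is the whole dual.
  have hR : R = ⊤ := by
    have h1 : R.dualCoannihilator = ⊥ := by
      refine (Submodule.eq_bot_iff _).2 fun x hx => ?_
      rw [Submodule.mem_dualCoannihilator] at hx
      exact Subtype.ext (hD x.1 fun d hd => hx _ ⟨d, hd, rfl⟩)
    rw [← Subspace.dualCoannihilator_dualAnnihilator_eq (W := R), h1,
      Submodule.dualAnnihilator_bot]
  let b := Module.finBasis k W
  let B := Basis.piTensorProduct fun _ : Fin r => b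
  have hrepr : B.repr w' = 0 := by
    refine Finsupp.ext fun p => ?_
    have h2 : ∀ i, ∃ d ∈ D, Module.Dual.transpose W.subtype d = b.coord (p i) := fun i => by
      have : b.coord (p i) ∈ R := hR ▸ Submodule.mem_top
      exact this
    -- Each coordinate functional on `W` lifts to an element of `D`; the tensor product of the lifts
    -- restricts to the coordinate `p` of the tensor power.
    choose d hd hdp using h2
    have h3 := hw d hd
    have h4 : dualProd d ∘ₗ (PiTensorProduct.map fun _ : Fin r => W.subtype) = B.coord p := by
      refine PiTensorProduct.ext (MultilinearMap.ext fun v => ?_)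
      simp only [LinearMap.compMultilinearMap_apply, LinearMap.comp_apply,
        PiTensorProduct.map_tprod, dualProd_tprod, Module.Basis.coord_apply, B,
        Basis.piTensorProduct_repr_tprod_apply]
      exact Finset.prod_congr rfl fun i _ => LinearMap.congr_fun (hdp i) (v i)
    rw [Finsupp.zero_apply, ← Module.Basis.coord_apply, ← h4]
    exact h3
  rw [B.repr.map_eq_zero_iff.1 hrepr, map_zero]

theorem cyc_atPos (i : Fin r) (g : Module.End k V) (w : TPow k V r) :
    cyc k V r (atPos i g w) = atPos (finRotate r i) g (cyc k V r w) := by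
  refine LinearMap.congr_fun (f := (cyc k V r).toLinearMap ∘ₗ atPos i g)
    (g := atPos (finRotate r i) g ∘ₗ (cyc k V r).toLinearMap)
    (PiTensorProduct.ext (MultilinearMap.ext fun v => ?_)) w
  simp only [LinearMap.compMultilinearMap_apply, LinearMap.comp_apply, LinearEquiv.coe_coe,
    atPos_tprod, cyc_tprod]
  refine congrArg _ (funext fun j => ?_)
  by_cases hj : j = finRotate r i
  · subst hj
    rw [Equiv.symm_apply_apply, Function.update_self, Function.update_self]
  · have hj' : (finRotate r).symm j ≠ i := fun h => hj (by rw [← h, Equiv.apply_symm_apply])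
    rw [Function.update_of_ne hj, Function.update_of_ne hj']

/-- Pure tensors are expanded into homogeneous ones slot by slot; `s` holds the slots that need not
be homogeneous yet. -/
theorem iSup_tpowGr {G : ℕ → Submodule k V} (hG : ⨆ n, G n = ⊤) : ⨆ n, tpowGr G r n = ⊤ := by
  have key : ∀ s : Finset (Fin r), ∀ v : Fin r → V, (∀ i ∉ s, ∃ n, v i ∈ G n) →
      PiTensorProduct.tprod k v ∈ ⨆ n, tpowGr G r n := by
    intro s
    induction s using Finset.induction_on with
    | empty =>
      intro v hv
      choose d hd using fun i => hv i (Finset.notMem_empty i)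
      exact Submodule.mem_iSup_of_mem (∑ i, d i)
        (Submodule.mem_iSup_of_mem d (Submodule.mem_iSup_of_mem rfl
          (Submodule.subset_span ⟨v, hd, rfl⟩)))
    | insert i s _ ih =>
      intro v hv
      have hupd : ∀ x ∈ ⨆ n, G n,
          PiTensorProduct.tprod k (Function.update v i x) ∈ ⨆ n, tpowGr G r n := by
        intro x hx
        induction hx using Submodule.iSup_induction' with
        | zero =>
          rw [MultilinearMap.map_update_zero]
          exact Submodule.zero_mem _
        | add x y _ _ hx hy =>
          rw [MultilinearMap.map_update_add]
          exact Submodule.add_mem _ hx hy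
        | mem n x hx =>
          refine ih _ fun j hj => ?_
          by_cases hji : j = i
          · subst hji
            exact ⟨n, by rwa [Function.update_self]⟩
          · rw [Function.update_of_ne hji]
            exact hv j (by simp [hji, hj])
      have := hupd (v i) (hG ▸ Submodule.mem_top)
      rwa [Function.update_eq_self] at this
  rw [eq_top_iff, ← PiTensorProduct.span_tprod_eq_top, Submodule.span_le]
  rintro _ ⟨v, rfl⟩
  exact key Finset.univ v fun i hi => absurd (Finset.mem_univ i) hi

end TensorPower

/-! ### Substitutions `t ↦ ζⁱt` and the Chinese remainder theorem. -/

section Remainder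

variable {ζ : kˣ} {r : ℕ}

theorem toLaurent_comp (z : kˣ) (p : k[X]) :
    toLaurent (p.comp (Polynomial.C (z : k) * X)) = scale z (toLaurent p) := by
  have h : (toLaurentAlg (R := k)).comp (Polynomial.aeval (Polynomial.C (z : k) * X)) =
      (scale z).comp toLaurentAlg := by
    refine Polynomial.algHom_ext ?_
    rw [AlgHom.comp_apply, AlgHom.comp_apply, aeval_X, toLaurentAlg_apply, toLaurentAlg_apply,
      toLaurent_X, T, scale_single, map_mul, toLaurent_C, toLaurent_X, zpow_one, one_mul,
      ← single_eq_C_mul_T]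
  have := DFunLike.congr_fun h p
  rwa [AlgHom.comp_apply, AlgHom.comp_apply, toLaurentAlg_apply, toLaurentAlg_apply,
    ← Polynomial.comp_eq_aeval] at this

theorem act_charPoly (ψ : ℤ → k) : act k (toLaurent (charPoly ψ)) ψ = 0 := by
  have h1 : charPoly ψ ∈ annIdeal ψ :=
    Ideal.mul_mem_left _ _ (Submodule.IsPrincipal.generator_mem (annIdeal ψ))
  exact h1

variable {ψ : ℤ → k}

theorem act_eq_zero_of_dvd {b : k[T;T⁻¹]} (hb : toLaurent (charPoly ψ) ∣ b) : act k b ψ = 0 := by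
  obtain ⟨c, rfl⟩ := hb
  rw [mul_comm, map_mul, Module.End.mul_apply, act_charPoly, map_zero]

/-- By the Chinese remainder theorem the action on a single factor comes from the loop algebra. -/
theorem exists_scale_congr
    (hco : ∀ i < r, ∀ j < r, i ≠ j →
      IsCoprime ((charPoly ψ).comp (Polynomial.C ((ζ : k) ^ i) * X))
        ((charPoly ψ).comp (Polynomial.C ((ζ : k) ^ j) * X)))
    (i : Fin r) (a : k[T;T⁻¹]) : ∃ b : k[T;T⁻¹],
      toLaurent (charPoly ψ) ∣ scale (ζ ^ (i : ℕ)) b - a ∧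
      ∀ j : Fin r, j ≠ i → toLaurent (charPoly ψ) ∣ scale (ζ ^ (j : ℕ)) b := by
  set c : k[T;T⁻¹] := toLaurent (charPoly ψ) with hc
  -- Undoing the substitutions: if `q j` divides `b`, then `c` divides `b(ζʲt)`, so all conditions
  -- bear on `b` itself.
  let q : Fin r → k[T;T⁻¹] := fun j => scale (ζ ^ (j : ℕ))⁻¹ c
  have hdvd : ∀ (j : Fin r) (b : k[T;T⁻¹]), q j ∣ b → c ∣ scale (ζ ^ (j : ℕ)) b := by
    intro j b h
    have := map_dvd (scale (ζ ^ (j : ℕ))) h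
    rwa [scale_comp, mul_inv_cancel, scale_one] at this
  have hq : ∀ j, j ≠ i → IsCoprime (q i) (q j) := by
    intro j hj
    -- Coprimality is given for `c(ζʲt)` and `c(ζⁱt)`; the substitution `t ↦ ζ⁻ⁱ⁻ʲt` turns them into
    -- `q i` and `q j`.
    have h1 := hco j j.2 i i.2 (fun h => hj (Fin.ext h))
    have h2 := (h1.map (toLaurent : k[X] →+* k[T;T⁻¹])).map
      (scale ((ζ ^ (i : ℕ))⁻¹ * (ζ ^ (j : ℕ))⁻¹)).toRingHom
    rw [← Units.val_pow_eq_pow_val, ← Units.val_pow_eq_pow_val, toLaurent_comp,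
      toLaurent_comp] at h2
    change IsCoprime (scale _ (scale _ c)) (scale _ (scale _ c)) at h2
    rw [scale_comp, scale_comp, inv_mul_cancel_right, mul_right_comm, inv_mul_cancel,
      one_mul] at h2
    exact h2
  have hprod : IsCoprime (q i) (∏ j ∈ Finset.univ.erase i, q j) :=
    IsCoprime.prod_right fun j hj => hq j (Finset.ne_of_mem_erase hj)
  obtain ⟨s, t, hst⟩ := hprod
  -- By the Bézout relation `hst`, the second factor is `1` modulo `q i` and `0` modulo the other `q
  -- j`.
  refine ⟨scale (ζ ^ (i : ℕ))⁻¹ a * (t * ∏ j ∈ Finset.univ.erase i, q j), ?_, fun j hj => ?_⟩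
  · have h1 : scale (ζ ^ (i : ℕ))⁻¹ a * (t * ∏ j ∈ Finset.univ.erase i, q j) -
        scale (ζ ^ (i : ℕ))⁻¹ a = q i * (-(scale (ζ ^ (i : ℕ))⁻¹ a * s)) := by
      linear_combination (scale (ζ ^ (i : ℕ))⁻¹ a) * hst
    have h2 := hdvd i _ (Dvd.intro _ h1.symm)
    rwa [map_sub, scale_comp _ _ a, mul_inv_cancel, scale_one] at h2
  · refine hdvd j _ (Dvd.dvd.mul_left (Dvd.dvd.mul_left ?_ _) _)
    exact Finset.dvd_prod_of_mem q (Finset.mem_erase.2 ⟨hj, Finset.mem_univ j⟩)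

/-- On `tⁿ` the left side is `∑ᵢ ζⁱⁿ ψ(n) = κ_r(n) ψ(n)`. It makes `φ` the highest weight of the
twisted tensor power. -/
theorem ev_scale_sum (hr : 0 < r) (hζ : IsPrimitiveRoot ζ r) {φ : ℤ → k}
    (hφψ : ∀ m, φ m = kron k r m * ψ m) (a : k[T;T⁻¹]) :
    ∑ i : Fin r, ev ψ (scale (ζ ^ (i : ℕ)) a) = ev φ a := by
  have hζ' : IsPrimitiveRoot (ζ : k) r := IsPrimitiveRoot.coe_units_iff.2 hζ
  classical
  have hk : ∀ n : ℤ, kron k r n = ∑ i : Fin r, (((ζ ^ (i : ℕ)) ^ n : kˣ) : k) := by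
    intro n
    have himg : nthRootsFinset r (1 : k) =
        (Finset.range r).image fun i => (ζ : k) ^ i := by
      ext z
      rw [mem_nthRootsFinset hr, Finset.mem_image]
      constructor
      · intro hz
        obtain ⟨i, hi, hiz⟩ := haveI := NeZero.of_pos hr; hζ'.eq_pow_of_pow_eq_one hz
        exact ⟨i, Finset.mem_range.2 hi, hiz⟩
      · rintro ⟨i, _, rfl⟩
        rw [← pow_mul, mul_comm, pow_mul, hζ'.pow_eq_one, one_pow]
    rw [kron, himg, Finset.sum_image, Finset.sum_range]
    · exact Finset.sum_congr rfl fun i _ => by push_cast; rfl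
    · intro i hi j hj hij
      exact hζ'.pow_inj (Finset.mem_range.1 hi) (Finset.mem_range.1 hj) hij
  have key : ∑ i : Fin r, ev ψ ∘ₗ (scale (ζ ^ (i : ℕ))).toLinearMap = ev φ :=
    laurent_hom_ext fun n => by
      have hs : ∀ z : kˣ, scale z (T n) = ((z ^ n : kˣ) : k) • T n := by
        intro z
        rw [T, scale_single, one_mul, AddMonoidAlgebra.smul_single, smul_eq_mul, mul_one]
      rw [LinearMap.sum_apply, ev_T, hφψ, hk, Finset.sum_mul]
      refine Finset.sum_congr rfl fun i _ => ?_
      rw [LinearMap.comp_apply, AlgHom.toLinearMap_apply, hs, map_smul, ev_T, smul_eq_mul]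
  rw [← key, LinearMap.sum_apply]
  rfl

end Remainder

/-! ## The action of the loop algebra on the tensor power -/

section TensorAction

variable {V : Type*} [AddCommGroup V] [Module k V] (ρ : U k →ₐ[k] Module.End k V) (ζ : kˣ) (r : ℕ)

/-- The action of the enveloping algebra on the `i`-th tensor factor, twisted by `ζ ^ i`. -/
def factorRep (i : Fin r) : U k →ₐ[k] Module.End k (TPow k V r) :=
  (atPos i).comp ((ρ).comp (twist (ζ ^ (i : ℕ))))

theorem factorRep_el (i : Fin r) (x : Sl2 k) (a : k[T;T⁻¹]) :
    factorRep ρ ζ r i (el x a) = atPos i (ρ (el x (scale (ζ ^ (i : ℕ)) a))) := by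
  rw [factorRep, AlgHom.comp_apply, AlgHom.comp_apply, twist_el]

/-- The action of the loop algebra on the tensor power. -/
def tensorLie : Loop k →ₗ⁅k⁆ Module.End k (TPow k V r) where
  __ := ∑ i : Fin r, (factorRep ρ ζ r i).toLinearMap ∘ₗ
    (UniversalEnvelopingAlgebra.ι k : Loop k →ₗ⁅k⁆ U k).toLinearMap
  map_lie' {y z} := by
    change (∑ i : Fin r, (factorRep ρ ζ r i).toLinearMap ∘ₗ
      (UniversalEnvelopingAlgebra.ι k : Loop k →ₗ⁅k⁆ U k).toLinearMap) ⁅y, z⁆ =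
        ⁅(∑ i : Fin r, (factorRep ρ ζ r i).toLinearMap ∘ₗ
          (UniversalEnvelopingAlgebra.ι k : Loop k →ₗ⁅k⁆ U k).toLinearMap) y,
        (∑ i : Fin r, (factorRep ρ ζ r i).toLinearMap ∘ₗ
          (UniversalEnvelopingAlgebra.ι k : Loop k →ₗ⁅k⁆ U k).toLinearMap) z⁆
    simp only [LinearMap.sum_apply, LinearMap.comp_apply, LieHom.coe_toLinearMap, LieHom.map_lie,
      LieRing.of_associative_ring_bracket, AlgHom.toLinearMap_apply, map_sub, map_mul]
    -- Actions on different factors commute, so only the diagonal terms of the double sum survive.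
    rw [Finset.sum_mul_sum, Finset.sum_mul_sum, Finset.sum_comm (f := fun i j =>
      factorRep ρ ζ r i (UniversalEnvelopingAlgebra.ι k z) *
        factorRep ρ ζ r j (UniversalEnvelopingAlgebra.ι k y)), ← Finset.sum_sub_distrib]
    refine Finset.sum_congr rfl fun i _ => ?_
    rw [← Finset.sum_sub_distrib, Finset.sum_eq_single_of_mem i (Finset.mem_univ i)]
    intro j _ hj
    rw [sub_eq_zero]
    exact atPos_commute hj.symm _ _

/-- The action of the enveloping algebra on the tensor power. -/
def tensorRep : U k →ₐ[k] Module.End k (TPow k V r) :=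
  UniversalEnvelopingAlgebra.lift k (tensorLie ρ ζ r)

theorem tensorRep_el (x : Sl2 k) (a : k[T;T⁻¹]) : tensorRep ρ ζ r (el x a) =
    ∑ i : Fin r, atPos i (ρ (el x (scale (ζ ^ (i : ℕ)) a))) := by
  simp only [← factorRep_el]
  rw [tensorRep, el, UniversalEnvelopingAlgebra.lift_ι_apply]
  exact LinearMap.sum_apply _ _ _

theorem tensorRep_el_tprod (x : Sl2 k) (a : k[T;T⁻¹]) (v : Fin r → V) :
    tensorRep ρ ζ r (el x a) (PiTensorProduct.tprod k v) = ∑ i : Fin r,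
      PiTensorProduct.tprod k (Function.update v i (ρ (el x (scale (ζ ^ (i : ℕ)) a)) (v i))) := by
  rw [tensorRep_el, LinearMap.sum_apply]
  exact Finset.sum_congr rfl fun i _ => atPos_tprod _ _ _

variable {ζ r}

theorem cyc_tensorRep (hζ : ζ ^ r = 1) (x : Sl2 k) (a : k[T;T⁻¹]) (w : TPow k V r) :
    cyc k V r (tensorRep ρ ζ r (el x a) w) =
      tensorRep ρ ζ r (el x (scale ζ⁻¹ a)) (cyc k V r w) := by
  -- Position `i` moves to `i + 1`, where the twist has one more `ζ`; the wrap-around from `r - 1`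
  -- to `0` needs `ζ ^ r = 1`.
  have hrot : ∀ i : Fin r, ζ ^ ((finRotate r i : Fin r) : ℕ) * ζ⁻¹ = ζ ^ (i : ℕ) := by
    intro i
    cases r with
    | zero => exact i.elim0
    | succ n =>
      rw [finRotate_apply, Fin.val_add, ← pow_eq_pow_mod _ hζ, pow_add, Fin.val_one']
      rw [← pow_eq_pow_mod _ hζ, pow_one, mul_inv_cancel_right]
  rw [tensorRep_el, tensorRep_el, LinearMap.sum_apply, LinearMap.sum_apply, map_sum]
  refine Finset.sum_equiv (finRotate r) (by simp) fun i _ => ?_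
  rw [cyc_atPos, scale_comp, hrot]

variable {ρ}

variable {ψ : ℤ → k}

/-- For a generator `x ⊗ a`, the `b` of `exists_scale_congr` acts like `a` on factor `i` and by zero
on the others. This yields both generation and non-degeneracy of the tensor power. -/
theorem atPos_mem_range
    (hco : ∀ i < r, ∀ j < r, i ≠ j →
      IsCoprime ((charPoly ψ).comp (Polynomial.C ((ζ : k) ^ i) * X))
        ((charPoly ψ).comp (Polynomial.C ((ζ : k) ^ j) * X)))
    (hann : ∀ b, act k b ψ = 0 → ∀ x, ρ (el x b) = 0)
    (i : Fin r) (u : U k) : atPos i (ρ u) ∈ (tensorRep ρ ζ r).range := by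
  induction u using u_induction with
  | hel x a =>
    obtain ⟨b, hb, hb'⟩ := exists_scale_congr hco i a
    refine ⟨el x b, ?_⟩
    change tensorRep ρ ζ r (el x b) = _
    rw [tensorRep_el, Finset.sum_eq_single_of_mem i (Finset.mem_univ i)]
    · have h1 := hann _ (act_eq_zero_of_dvd hb) x
      rw [← elL_apply, map_sub, map_sub, sub_eq_zero] at h1
      exact congrArg _ h1
    · intro j _ hj
      rw [hann _ (act_eq_zero_of_dvd (hb' j hj)) x, map_zero]
  | hc c =>
    rw [AlgHom.commutes, AlgHom.commutes]
    exact Subalgebra.algebraMap_mem _ c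
  | hadd u v hu hv =>
    rw [map_add, map_add]
    exact Subalgebra.add_mem _ hu hv
  | hmul u v hu hv =>
    rw [map_mul, map_mul]
    exact Subalgebra.mul_mem _ hu hv

theorem exists_tensorRep_eq_map
    (hco : ∀ i < r, ∀ j < r, i ≠ j →
      IsCoprime ((charPoly ψ).comp (Polynomial.C ((ζ : k) ^ i) * X))
        ((charPoly ψ).comp (Polynomial.C ((ζ : k) ^ j) * X)))
    (hann : ∀ b, act k b ψ = 0 → ∀ x, ρ (el x b) = 0)
    (u : Fin r → U k) :
    ∃ y : U k, tensorRep ρ ζ r y = PiTensorProduct.map fun i => ρ (u i) :=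
  map_mem_of_atPos_mem (S := (tensorRep ρ ζ r).range) fun i => atPos_mem_range hco hann i (u i)

theorem isHighestWeight_tensor {v : V} (hv : IsHighestWeight ρ ψ v) (hr : 0 < r) (hζ : IsPrimitiveRoot ζ r) {φ : ℤ → k}
    (hφψ : ∀ m, φ m = kron k r m * ψ m)
    (hco : ∀ i < r, ∀ j < r, i ≠ j →
      IsCoprime ((charPoly ψ).comp (Polynomial.C ((ζ : k) ^ i) * X))
        ((charPoly ψ).comp (Polynomial.C ((ζ : k) ^ j) * X)))
    (hann : ∀ b, act k b ψ = 0 → ∀ x, ρ (el x b) = 0) :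
    IsHighestWeight (tensorRep ρ ζ r) φ (PiTensorProduct.tprod k fun _ => v) where
  annihilated a := by
    rw [tensorRep_el_tprod]
    refine Finset.sum_eq_zero fun i _ => ?_
    rw [hv.annihilated, MultilinearMap.map_update_zero]
  weight a := by
    rw [tensorRep_el_tprod, ← ev_scale_sum hr hζ hφψ, Finset.sum_smul]
    refine Finset.sum_congr rfl fun i _ => ?_
    rw [hv.weight, MultilinearMap.map_update_smul, Function.update_eq_self]
  gen w := by
    let B : U k →ₗ[k] TPow k V r :=
      LinearMap.applyₗ (PiTensorProduct.tprod k fun _ => v) ∘ₗ (tensorRep ρ ζ r).toLinearMap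
    have hB : LinearMap.range B = ⊤ := by
      rw [eq_top_iff, ← PiTensorProduct.span_tprod_eq_top, Submodule.span_le]
      rintro _ ⟨v', rfl⟩
      choose u hu using fun i => hv.gen (v' i)
      obtain ⟨y, hy⟩ := exists_tensorRep_eq_map hco hann u
      refine ⟨y, ?_⟩
      change tensorRep ρ ζ r y _ = _
      rw [hy, PiTensorProduct.map_tprod]
      exact congrArg _ (funext hu)
    exact LinearMap.range_eq_top.1 hB w

theorem dualProd_slF {δ : V →ₗ[k] k} (hδ : ∀ a w, δ (ρ (el (slF k) a) w) = 0) (a : k[T;T⁻¹]) (w : TPow k V r) :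
    dualProd (fun _ => δ) (tensorRep ρ ζ r (el (slF k) a) w) = 0 := by
  refine LinearMap.congr_fun (f := dualProd (fun _ => δ) ∘ₗ tensorRep ρ ζ r (el (slF k) a))
    (g := 0) (PiTensorProduct.ext (MultilinearMap.ext fun v => ?_)) w
  rw [LinearMap.compMultilinearMap_apply, LinearMap.comp_apply, tensorRep_el_tprod, map_sum]
  refine Finset.sum_eq_zero fun i _ => ?_
  rw [dualProd_tprod]
  refine Finset.prod_eq_zero (Finset.mem_univ i) ?_
  rw [Function.update_self, hδ]

/-- The functionals `w ↦ δ (u w)` separate points of `V`, so their tensor products separate points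
of the tensor power; each such product is `δ ⊗ ⋯ ⊗ δ` preceded by some element of the enveloping
algebra. -/
theorem eq_zero_of_dualProd_tensorRep {δ : V →ₗ[k] k}
    (hnd : ∀ w, (∀ u, δ (ρ u w) = 0) → w = 0)
    (hco : ∀ i < r, ∀ j < r, i ≠ j →
      IsCoprime ((charPoly ψ).comp (Polynomial.C ((ζ : k) ^ i) * X))
        ((charPoly ψ).comp (Polynomial.C ((ζ : k) ^ j) * X)))
    (hann : ∀ b, act k b ψ = 0 → ∀ x, ρ (el x b) = 0)
    {w : TPow k V r} (hw : ∀ u, dualProd (fun _ => δ) (tensorRep ρ ζ r u w) = 0) :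
    w = 0 := by
  let D : Submodule k (Module.Dual k V) :=
    LinearMap.range ((LinearMap.compRight k δ) ∘ₗ (ρ).toLinearMap)
  refine eq_zero_of_dualProd (D := D) (fun v hv => ?_) fun d hd => ?_
  · exact hnd v fun u => hv _ ⟨u, rfl⟩
  · choose u hu using hd
    obtain ⟨y, hy⟩ := exists_tensorRep_eq_map hco hann u
    have h1 := hw y
    rw [hy, dualProd_map] at h1
    rw [← h1]
    exact congrArg (fun d => dualProd d w) (funext fun i => (hu i).symm)

/-- The substitutions fix `h ⊗ 1`, so the weights `c - 2 dᵢ` of the factors simply add. -/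
theorem tpowGr_le_eigenspace (c : k) (n : ℕ) :
    tpowGr (fun n : ℕ => (ρ (el (slH k) 1)).eigenspace (c - 2 * n)) r n ≤
      (tensorRep ρ ζ r (el (slH k) 1)).eigenspace (r * c - 2 * n) := by
  refine iSup₂_le fun d hd => Submodule.span_le.2 ?_
  rintro _ ⟨v, hv, rfl⟩
  rw [SetLike.mem_coe, Module.End.mem_eigenspace_iff, tensorRep_el_tprod]
  have h1 : ∀ i : Fin r, PiTensorProduct.tprod k
      (Function.update v i (ρ (el (slH k) (scale (ζ ^ (i : ℕ)) 1)) (v i))) =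
      (c - 2 * (d i : k)) • PiTensorProduct.tprod k v := by
    intro i
    have h2 : ρ (el (slH k) 1) (v i) = (c - 2 * (d i : k)) • v i :=
      Module.End.mem_eigenspace_iff.1 (hv i)
    rw [map_one, h2, MultilinearMap.map_update_smul, Function.update_eq_self]
  have h3 : ∑ i, d i = n := hd
  rw [Finset.sum_congr rfl fun i _ => h1 i, ← Finset.sum_smul, Finset.sum_sub_distrib,
    ← Finset.mul_sum, ← Nat.cast_sum, h3]
  simp

/-- `L(φ)` is isomorphic, as a graded space with automorphism, to the tensor power of a
non-degenerate highest-weight module `V` of weight `ψ`. -/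
theorem exists_tensor_equiv [CharZero k] {φ : ℤ → k} (hφ : φ ∈ expPoly k) (hφ0 : φ ≠ 0)
    (hζ : IsPrimitiveRoot ζ (degree φ)) (hφψ : IsExpression φ ψ (degree φ) ζ)
    (hann : ∀ b, act k b ψ = 0 → ∀ x, ρ (el x b) = 0)
    {v : V} (hv : IsHighestWeight ρ ψ v) {δ : V →ₗ[k] k} (hδv : δ v = 1)
    (hδ : ∀ a w, δ (ρ (el (slF k) a) w) = 0) (hnd : ∀ w, (∀ u, δ (ρ u w) = 0) → w = 0) :
    ∃ Ω : L φ ≃ₗ[k] TPow k V (degree φ),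
      (∀ n, (gr φ n).map Ω.toLinearMap =
        tpowGr (fun n : ℕ => (ρ (el (slH k) 1)).eigenspace (ψ 0 - 2 * n)) (degree φ) n) ∧
      cyc k V (degree φ) = Ω.symm ≪≫ₗ eta hφ hφ0 hζ.pow_eq_one ≪≫ₗ Ω := by
  have hr : 0 < degree φ := (isDegree_degree hφ hφ0).1
  -- The case `a = 1` of `ev_scale_sum`; it matches the top weights of the two gradings.
  have h0 : φ 0 = degree φ * ψ 0 := by
    have := ev_scale_sum hr hζ hφψ.eq_mul 1
    simp only [map_one, ev_one] at this
    rw [← this]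
    simp
  obtain ⟨Ω, hΩ⟩ := exists_equiv_of_isHighestWeight
    (isHighestWeight_tensor hv hr hζ hφψ.eq_mul hφψ.coprime hann) (dualProd fun _ => δ)
    (by rw [dualProd_tprod]; simp [hδv]) (dualProd_slF hδ)
    (fun w hw => eq_zero_of_dualProd_tensorRep hnd hφψ.coprime hann hw)
  have hΩ' : ∀ (u : U k) (w : L φ), Ω (u • w) = tensorRep ρ ζ (degree φ) u (Ω w) := by
    intro u w
    obtain ⟨y, rfl⟩ := exists_smul_vac φ w
    rw [← mul_smul, hΩ, hΩ, map_mul, Module.End.mul_apply]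
  refine ⟨Ω, fun n => ?_, ?_⟩
  · have htop : ⨆ n : ℕ, (ρ (el (slH k) 1)).eigenspace (ψ 0 - 2 * n) = ⊤ :=
      eq_top_iff.2 (hv.iSup_layer.ge.trans (iSup_mono hv.layer_le))
    have hle : ∀ n, tpowGr (fun n : ℕ => (ρ (el (slH k) 1)).eigenspace (ψ 0 - 2 * n))
        (degree φ) n ≤
        (tensorRep ρ ζ (degree φ) (el (slH k) 1)).eigenspace (φ 0 - 2 * (n : k)) := fun n => by
      rw [h0]
      exact tpowGr_le_eigenspace (ψ 0) n
    -- The pieces `tpowGr` span and lie in distinct eigenspaces of `h ⊗ 1`, so they are these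
    -- eigenspaces, and `Ω` intertwines `h ⊗ 1`.
    rw [← eigenspace_eq_of_le (weight_injective (φ 0)) hle (iSup_tpowGr htop) n]
    ext x
    rw [Submodule.mem_map_equiv, Module.End.mem_eigenspace_iff, gr, Module.End.mem_eigenspace_iff,
      ← Ω.injective.eq_iff, map_smul, Ω.apply_symm_apply]
    change Ω (el (slH k) 1 • Ω.symm x) = _ ↔ _
    rw [hΩ', Ω.apply_symm_apply]
  -- The rotation transported to `L(φ)` fixes the highest-weight vector and twists the action as
  -- `eta` does.
  · have h1 := eta_unique hφ hφ0 hζ.pow_eq_one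
      (Ω.symm.toLinearMap ∘ₗ (cyc k V (degree φ)).toLinearMap ∘ₗ Ω.toLinearMap) ?_ ?_
    · refine LinearEquiv.ext fun x => ?_
      have h2 := LinearMap.congr_fun h1 (Ω.symm x)
      simp only [LinearMap.comp_apply, LinearEquiv.coe_coe, Ω.apply_symm_apply] at h2
      rw [LinearEquiv.trans_apply, LinearEquiv.trans_apply, ← h2, Ω.apply_symm_apply]
    · have h2 : Ω (vac φ) = PiTensorProduct.tprod k fun _ => v := by
        rw [← one_smul (U k) (vac φ), hΩ, map_one, Module.End.one_apply]
      simp only [LinearMap.comp_apply, LinearEquiv.coe_coe]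
      rw [h2, cyc_tprod, ← h2, Ω.symm_apply_apply]
    · intro x a w
      simp only [LinearMap.comp_apply, LinearEquiv.coe_coe]
      rw [hΩ', cyc_tensorRep ρ hζ.pow_eq_one, LinearEquiv.symm_apply_eq, hΩ', Ω.apply_symm_apply]

end TensorAction
-- The case `V = L(ψ)` and the proposition.
theorem gr_eq_eigenspace (ψ : ℤ → k) :
    (fun n : ℕ => (lRep ψ (el (slH k) 1)).eigenspace (ψ 0 - 2 * n)) = gr ψ := rfl

theorem exists_equiv_tpow [CharZero k] {φ ψ : ℤ → k} {ζ : kˣ} (hφ : φ ∈ expPoly k) (hφ0 : φ ≠ 0)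
    (hζ : IsPrimitiveRoot ζ (degree φ)) (hφψ : IsExpression φ ψ (degree φ) ζ) :
    ∃ Ω : L φ ≃ₗ[k] TPow k (L ψ) (degree φ),
      (∀ n, (gr φ n).map Ω.toLinearMap = tpowGr (gr ψ) (degree φ) n) ∧
      cyc k (L ψ) (degree φ) = Ω.symm ≪≫ₗ eta hφ hφ0 hζ.pow_eq_one ≪≫ₗ Ω := by
  have hann : ∀ b, act k b ψ = 0 → ∀ x, lRep ψ (el x b) = 0 := fun b hb x =>
    LinearMap.ext fun w => el_smul_eq_zero hb x w
  have h := exists_tensor_equiv hφ hφ0 hζ hφψ hann (isHighestWeight_l ψ) (epsL_vac ψ)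
    (epsL_slF_smul ψ) (fun w hw => eq_zero_of_epsL ψ hw)
  rw [gr_eq_eigenspace] at h
  exact h

end LoopSl2

end

theorem mainTheorem4 {k : Type*} [Field k] [IsAlgClosed k] [CharZero k]
    (φ ψ : ℤ → k) (hφ : φ ∈ LoopSl2.expPoly k) (hφ0 : φ ≠ 0) (hψ : ψ ∈ LoopSl2.expPoly k)
    (ζ : kˣ) (hζ : IsPrimitiveRoot ζ (LoopSl2.degree φ))
    (hφψ : LoopSl2.IsExpression φ ψ (LoopSl2.degree φ) ζ) :
    LoopSl2.IsNatGrading (LoopSl2.gr φ) ∧ LoopSl2.IsNatGrading (LoopSl2.gr ψ) ∧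
    ∃ Ω : LoopSl2.L φ ≃ₗ[k] LoopSl2.TPow k (LoopSl2.L ψ) (LoopSl2.degree φ),
      (∀ n, (LoopSl2.gr φ n).map Ω.toLinearMap =
        LoopSl2.tpowGr (LoopSl2.gr ψ) (LoopSl2.degree φ) n) ∧
      LoopSl2.cyc k (LoopSl2.L ψ) (LoopSl2.degree φ) =
        Ω.symm ≪≫ₗ LoopSl2.eta hφ hφ0 hζ.pow_eq_one ≪≫ₗ Ω :=
  ⟨LoopSl2.isNatGrading_gr hφ, LoopSl2.isNatGrading_gr hψ,
    LoopSl2.exists_equiv_tpow hφ hφ0 hζ hφψ⟩
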